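/- \textbf{Theorem (Second-order convergence).} Let $L,\varepsilon,T>0$ and $\mathcal D=\partial/\partial x$. Consider one of the following two settings for real functions of $x$. (a) Dirichlet: functions on $\Omega=(0,L)$ vanishing at both ends, continued to $\mathbb R$ by odd reflection as $2L$-periodic functions; here $\mathcal L=0$ or $\mathcal L=-\delta\mathcal I$. (b) Periodic: $2L$-periodic functions, with $\Omega=(0,2L)$ one period; here $\mathcal L=0$, $\mathcal L=-\delta\mathcal I$ or $\mathcal L=\delta\mathcal D$. Here $\delta\in\mathbb R$ is a constant. Write $\|\varphi\|^2=\int_\Omega\varphi^2\,dx$ and $\mathcal H\psi(x)=\frac1\pi\,\mathrm{P.V.}\!\int_{\mathbb R}\frac{\psi(y)}{x-y}\,dy$ for the Hilbert transform (of the continued function). The operators $\Delta$, $\mathcal D$ and $\mathcal H\mathcal D$ are understood weakly, as operators in $L^2(\Omega)$ under the given boundary conditions. Let $v_0=-\varepsilon\mathcal H(\mathcal Du_0)+\mathcal Lu_0$, and let $(u,v)$ be a solution on $[0,T]$ of the spectrum-doubled system $$u_t=v+f,\qquad v_t=(-\varepsilon^2\Delta-\mathcal L^2)u+2\mathcal Lv+\mathcal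 Lf-\varepsilon\mathcal H(\mathcal Df),\qquad u(0)=u_0,\quad v(0)=v_0,$$ such that for every $t$ all terms are defined in $L^2(\Omega)$, and such that $u,v\in C^3([0,T];L^2(\Omega))$. For $N\ge1$ put $\tau=T/N$, $t_n=n\tau$, $f^n=f(t_n)$, and let $(u^n,v^n)_{0\le n\le N}$ be produced by the generalized midpoint boundary value method: $(u^0,v^0)=(u_0,v_0)$; for $1\le n\le N-1$ (midpoint rule) $$\frac{u^{n+1}-u^{n-1}}{2\tau}=v^n+f^n,\qquad \frac{v^{n+1}-v^{n-1}}{2\tau}=(-\varepsilon^2\Delta-\mathcal L^2)u^n+2\mathcal Lv^n+\mathcal Lf^n-\varepsilon\mathcal H(\mathcal Df^n);$$ and at the final step (backward Euler) $$\frac{u^{N}-u^{N-1}}{\tau}=v^N+f^N,\qquad \frac{v^{N}-v^{N-1}}{\tau}=(-\varepsilon^2\Delta-\mathcal L^2)u^N+2\mathcal Lv^N+\mathcal Lf^N-\varepsilon\mathcal H(\mathcal Df^N).$$ Then for small $\tau$ the method is second-order convergent at the final time $t_N=T$. Precisely, there is $\tau_0>0$, depending only on the setting, $L$, $\varepsilon$,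 $T$ and $\mathcal L$, and for all $f,u_0,u,v$ as above there is a constant $C>0$, independent of $N$ and $\tau$, such that for every $N\ge1$ with $\tau=T/N\le\tau_0$ and every $(u^n,v^n)_{0\le n\le N}$ produced by the method, the errors $e_u^N=u(T)-u^N$ and $e_v^N=v(T)-v^N$ satisfy $$\|e_u^N\|^2+\|e_v^N\|^2\le C\tau^4.$$ -/

import Mathlib

open Filter Topology MeasureTheory Set
open scoped ContDiff

noncomputable section

namespace SpectrumDoubling

/-- The two boundary settings for functions of the space variable `x`. In the Dirichlet setting,
functions live on `(0, ℓ)`, vanish at both ends, and are continued to the line by odd reflection to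
`2ℓ`-periodic functions; in the periodic setting they are arbitrary `2ℓ`-periodic functions. -/
inductive Boundary
  | dirichlet
  | periodic

/-- The space domain: `(0, ℓ)` in the Dirichlet setting, one period `(0, 2ℓ)` in the periodic
setting. -/
def domain (bc : Boundary) (ℓ : ℝ) : Set ℝ :=
  match bc with
  | .dirichlet => Ioo 0 ℓ
  | .periodic => Ioo 0 (2 * ℓ)

/-- Lebesgue measure on the space domain. -/
abbrev domainMeasure (bc : Boundary) (ℓ : ℝ) : Measure ℝ := volume.restrict (domain bc ℓ)

/-- The real Hilbert space `L²` of the space domain, with norm `‖φ‖² = ∫ φ²`. -/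
abbrev State (bc : Boundary) (ℓ : ℝ) : Type := Lp ℝ 2 (domainMeasure bc ℓ)

/-- Test functions: smooth `2ℓ`-periodic functions on the line, which are moreover odd in the
Dirichlet setting (so that they and their even derivatives vanish at `0` and at `ℓ`). -/
structure IsTest (bc : Boundary) (ℓ : ℝ) (φ : ℝ → ℝ) : Prop where
  smooth : ContDiff ℝ ∞ φ
  periodic : Function.Periodic φ (2 * ℓ)
  odd : bc = Boundary.dirichlet → ∀ x, φ (-x) = -φ x

/-- The pairing `∫ w φ` over the space domain. -/
def pairing {bc : Boundary} {ℓ : ℝ} (w : State bc ℓ) (φ : ℝ → ℝ) : ℝ :=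
  ∫ x, w x * φ x ∂(domainMeasure bc ℓ)

/-- `a` is the Hilbert transform `(1/π) P.V. ∫ ψ(y) / (x - y) dy` of `ψ` at the point `x`. The
principal value is taken at `y = x` and at infinity. -/
def HasHilbertTransformAt (ψ : ℝ → ℝ) (x a : ℝ) : Prop :=
  Tendsto
    (fun p : ℝ × ℝ =>
      (1 / Real.pi) * ∫ y in {y : ℝ | p.1 < |x - y| ∧ |x - y| < p.2}, ψ y / (x - y))
    (𝓝[>] (0 : ℝ) ×ˢ (atTop : Filter ℝ)) (𝓝 a)

/-- `w = D u` with `D = ∂/∂x`, weakly, for `2ℓ`-periodic functions. -/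
def IsDeriv {bc : Boundary} {ℓ : ℝ} (u w : State bc ℓ) : Prop :=
  ∀ φ, IsTest bc ℓ φ → pairing w φ = -pairing u (deriv φ)

/-- `w = Δ u`, weakly, under the boundary conditions of the setting. -/
def IsLaplacian {bc : Boundary} {ℓ : ℝ} (u w : State bc ℓ) : Prop :=
  ∀ φ, IsTest bc ℓ φ → pairing w φ = pairing u (deriv (deriv φ))

/-- `w = H (D u)`, where `H` is the Hilbert transform and `u` is continued to the line as the
setting prescribes. It is understood weakly: `H` and `D` commute and both are skew-symmetric, so
that `H D` is symmetric. For smooth periodic `φ` the principal value of `H (D φ)` exists at every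
point. -/
def IsHilbertDeriv {bc : Boundary} {ℓ : ℝ} (u w : State bc ℓ) : Prop :=
  ∀ φ, IsTest bc ℓ φ → ∃ χ : ℝ → ℝ,
    (∀ x, HasHilbertTransformAt (deriv φ) x (χ x)) ∧ pairing w φ = pairing u χ

/-- The differential operators `𝓛` under consideration: `𝓛 = 0`, `𝓛 = -δ I`, `𝓛 = δ D`. -/
inductive Drift
  | zero
  | reaction (δ : ℝ)
  | advection (δ : ℝ)

/-- The operator `δ D` is considered in the periodic setting only. -/
def Drift.Admissible (𝓛 : Drift) (bc : Boundary) : Prop :=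
  match 𝓛 with
  | .zero => True
  | .reaction _ => True
  | .advection _ => bc = Boundary.periodic

/-- `u` is in the domain of `𝓛`, and `w = 𝓛 u`. -/
def Drift.Maps {bc : Boundary} {ℓ : ℝ} (𝓛 : Drift) (u w : State bc ℓ) : Prop :=
  match 𝓛 with
  | .zero => w = 0
  | .reaction δ => w = -(δ • u)
  | .advection δ => ∃ Du : State bc ℓ, IsDeriv u Du ∧ w = δ • Du

/-- `w = (-ε² Δ - 𝓛²) u + 2 𝓛 v + 𝓛 f - ε H (D f)`, where `u`, `v` and `f` are in the domains of
the operators which are applied to them. -/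
def IsForce {bc : Boundary} {ℓ : ℝ} (ε : ℝ) (𝓛 : Drift) (u v f w : State bc ℓ) : Prop :=
  ∃ Δu 𝓛u 𝓛𝓛u 𝓛v 𝓛f HDf : State bc ℓ,
    IsLaplacian u Δu ∧ 𝓛.Maps u 𝓛u ∧ 𝓛.Maps 𝓛u 𝓛𝓛u ∧ 𝓛.Maps v 𝓛v ∧ 𝓛.Maps f 𝓛f ∧
      IsHilbertDeriv f HDf ∧
      w = (-(ε ^ 2 • Δu) - 𝓛𝓛u) + (2 : ℝ) • 𝓛v + 𝓛f - ε • HDf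

/-- `v₀ = -ε H (D u₀) + 𝓛 u₀`. -/
def IsInitialVelocity {bc : Boundary} {ℓ : ℝ} (ε : ℝ) (𝓛 : Drift) (u₀ v₀ : State bc ℓ) : Prop :=
  ∃ HDu₀ 𝓛u₀ : State bc ℓ, IsHilbertDeriv u₀ HDu₀ ∧ 𝓛.Maps u₀ 𝓛u₀ ∧ v₀ = -(ε • HDu₀) + 𝓛u₀

/-- `(u, v)` is a solution on `[0, T]` of the spectrum-doubled system
`u' = v + f`, `v' = -ε² Δ u + 2 𝓛 v - 𝓛² u + 𝓛 f - ε H (D f)`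
with `u(0) = u₀` and `v(0) = v₀`, and it is of class `C³` in time with values in `L²`. -/
structure IsExactSolution {bc : Boundary} {ℓ : ℝ} (ε : ℝ) (𝓛 : Drift) (T : ℝ)
    (f : ℝ → State bc ℓ) (u₀ v₀ : State bc ℓ) (u v : ℝ → State bc ℓ) : Prop where
  smooth_u : ContDiffOn ℝ 3 u (Icc 0 T)
  smooth_v : ContDiffOn ℝ 3 v (Icc 0 T)
  eq_u : ∀ t ∈ Icc 0 T, HasDerivWithinAt u (v t + f t) (Icc 0 T) t
  eq_v : ∀ t ∈ Icc 0 T, ∃ w : State bc ℓ,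
    IsForce ε 𝓛 (u t) (v t) (f t) w ∧ HasDerivWithinAt v w (Icc 0 T) t
  init_u : u 0 = u₀
  init_v : v 0 = v₀

/-- `(U n, V n)`, `0 ≤ n ≤ N`, is produced by the generalized midpoint method with step `τ`:
the midpoint rule for `1 ≤ n ≤ N - 1`, and backward Euler at `n = N`. -/
structure IsMidpointBVM {bc : Boundary} {ℓ : ℝ} (ε : ℝ) (𝓛 : Drift) (N : ℕ) (τ : ℝ)
    (f : ℝ → State bc ℓ) (u₀ v₀ : State bc ℓ) (U V : ℕ → State bc ℓ) : Prop where
  init_u : U 0 = u₀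
  init_v : V 0 = v₀
  mid_u : ∀ n, 1 ≤ n → n + 1 ≤ N →
    (1 / (2 * τ)) • (U (n + 1) - U (n - 1)) = V n + f (n * τ)
  mid_v : ∀ n, 1 ≤ n → n + 1 ≤ N →
    IsForce ε 𝓛 (U n) (V n) (f (n * τ)) ((1 / (2 * τ)) • (V (n + 1) - V (n - 1)))
  final_u : (1 / τ) • (U N - U (N - 1)) = V N + f (N * τ)
  final_v : IsForce ε 𝓛 (U N) (V N) (f (N * τ)) ((1 / τ) • (V N - V (N - 1)))

end SpectrumDoubling

end

/-! Every operator in the scheme acts diagonally on Fourier modes. If `λ` is the symbol of `𝓛` and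
`κ` the frequency, the doubled system has on each mode the two eigenvalues `a = λ - ε|κ|` (the
original equation) and `b = λ + ε|κ|` (spurious and growing). The combination `v - a u` evolves with
`b` alone, without forcing, and the choice of `v₀` makes it start at zero; so it vanishes for the
exact solution.

For the scheme, the same combination solves a homogeneous boundary value problem for the midpoint
rule with backward Euler at the end. It vanishes unless that problem is singular at `s = τ b`, and
the crux is that for large `N` no mode is singular (`exists_not_isSingular`). A singular `s` makes
`2s` an algebraic integer, while `2s` has the form `(α + βk)/N` with `Re β > 0`. Modes with `Re 2s`
bounded below are excluded by growth. For the others, if `α, β` are algebraic, all conjugates of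
`2s` have modulus below 1, so its norm is zero and `2s = 0`, which is not singular; if not, at most
one `k` can ever be singular, and on a fixed mode the scheme is stable for large `N`.

Once `v = a u` holds on both sides, the errors in `u` and in `v` each solve the scalar scheme with
eigenvalue `a`. It is stable uniformly in the mode: by an energy identity if `Re a ≤ -1`, by
factoring the recurrence if `a` is bounded. Parseval sums the modes in `exists_component_bound`. The
`N - 1` midpoint residuals of size `τ³` and the single final residual of size `τ²` both contribute
`τ⁴` to the squared error. -/

namespace SpectrumDoubling

/-! ### Stability of the scalar scheme. -/

/-- The midpoint rule with a final backward Euler step for the scalar equation `y' = μ y + r` with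
zero initial value, where `s = τ μ` and `g = τ r`. -/
structure IsScalarBVM (N : ℕ) (s : ℂ) (y g : ℕ → ℂ) : Prop where
  init : y 0 = 0
  mid : ∀ n, n + 2 ≤ N → y (n + 2) = y n + 2 * s * y (n + 1) + 2 * g (n + 1)
  final : y N = y (N - 1) + s * y N + g N

/-- Energy argument: pair the midpoint rule with `y (m + 1)`. The real inner product of consecutive
values grows only through the source, which the damping `2 Re s |y (m + 1)|²` absorbs by Young's
inequality. This product is indefinite; the final backward Euler step turns it into `|y N|²`. The
size of `s` plays no role. -/
theorem IsScalarBVM.norm_sq_le_of_re_neg {N : ℕ} {s : ℂ} {y g : ℕ → ℂ} (h : IsScalarBVM N s y g)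
    (hN : 1 ≤ N) {σ : ℝ} (hσ : 0 < σ) (hs : s.re ≤ -σ) :
    ‖y N‖ ^ 2 ≤ 1 / σ * ∑ n ∈ Finset.range (N - 1), ‖g (n + 1)‖ ^ 2 + ‖g N‖ ^ 2 := by
  have key : ∀ m, m + 1 ≤ N → (y m).re * (y (m + 1)).re + (y m).im * (y (m + 1)).im ≤
      1 / (2 * σ) * ∑ n ∈ Finset.range m, ‖g (n + 1)‖ ^ 2 := by
    intro m
    induction m with
    | zero => intro _; simp [h.init]
    | succ m ih =>
      intro hm
      have h1 := ih (by omega)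
      rw [Finset.sum_range_succ, mul_add, h.mid m hm]
      have h2 : 2 * ((y (m + 1)).re * (g (m + 1)).re + (y (m + 1)).im * (g (m + 1)).im) ≤
          2 * σ * ((y (m + 1)).re ^ 2 + (y (m + 1)).im ^ 2) + 1 / (2 * σ) * ‖g (m + 1)‖ ^ 2 := by
        rw [Complex.sq_norm, Complex.normSq_apply]
        have : 2 * σ * ((y (m + 1)).re ^ 2 + (y (m + 1)).im ^ 2) + 1 / (2 * σ) *
            ((g (m + 1)).re * (g (m + 1)).re + (g (m + 1)).im * (g (m + 1)).im) -
            2 * ((y (m + 1)).re * (g (m + 1)).re + (y (m + 1)).im * (g (m + 1)).im) =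
            1 / (2 * σ) * ((2 * σ * (y (m + 1)).re - (g (m + 1)).re) ^ 2 +
              (2 * σ * (y (m + 1)).im - (g (m + 1)).im) ^ 2) := by
          field_simp; ring
        have h0 : 0 ≤ 1 / (2 * σ) * ((2 * σ * (y (m + 1)).re - (g (m + 1)).re) ^ 2 +
              (2 * σ * (y (m + 1)).im - (g (m + 1)).im) ^ 2) := by positivity
        linarith
      have h3 : s.re * ((y (m + 1)).re ^ 2 + (y (m + 1)).im ^ 2) ≤
          -σ * ((y (m + 1)).re ^ 2 + (y (m + 1)).im ^ 2) :=
        mul_le_mul_of_nonneg_right hs (by positivity)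
      simp only [Complex.add_re, Complex.add_im, Complex.mul_re, Complex.mul_im, Complex.re_ofNat,
        Complex.im_ofNat]
      linarith
  obtain ⟨m, rfl⟩ : ∃ m, N = m + 1 := ⟨N - 1, by omega⟩
  have h1 := key m le_rfl
  have hf := h.final
  simp only [Nat.add_sub_cancel] at hf ⊢
  have hre := congrArg Complex.re hf
  have him := congrArg Complex.im hf
  simp only [Complex.add_re, Complex.add_im, Complex.mul_re, Complex.mul_im] at hre him
  have h3 : s.re * ((y (m + 1)).re ^ 2 + (y (m + 1)).im ^ 2) ≤ 0 :=
    mul_nonpos_of_nonpos_of_nonneg (by linarith) (by positivity)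
  have h4 : 1 / σ * ∑ n ∈ Finset.range m, ‖g (n + 1)‖ ^ 2 =
      2 * (1 / (2 * σ) * ∑ n ∈ Finset.range m, ‖g (n + 1)‖ ^ 2) := by
    field_simp
  rw [h4, Complex.sq_norm, Complex.sq_norm, Complex.normSq_apply, Complex.normSq_apply]
  have e1 : (y (m + 1)).re * (y (m + 1)).re + (y (m + 1)).im * (y (m + 1)).im =
      ((y m).re * (y (m + 1)).re + (y m).im * (y (m + 1)).im) +
      s.re * ((y (m + 1)).re ^ 2 + (y (m + 1)).im ^ 2) +
      ((y (m + 1)).re * (g (m + 1)).re + (y (m + 1)).im * (g (m + 1)).im) := by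
    linear_combination (y (m + 1)).re * hre + (y (m + 1)).im * him
  nlinarith [sq_nonneg ((y (m + 1)).re - (g (m + 1)).re),
    sq_nonneg ((y (m + 1)).im - (g (m + 1)).im)]

/-- A root of `z² = 2 s z + 1` near `1`. -/
theorem exists_root (s : ℂ) : ∃ z : ℂ, z ^ 2 = 2 * s * z + 1 ∧ s.re ≤ z.re ∧
    (‖s‖ ≤ 1 → ‖z - 1‖ ≤ 2 * ‖s‖) := by
  obtain ⟨q, hq, hre⟩ : ∃ q : ℂ, q ^ 2 = 1 + s ^ 2 ∧ 0 ≤ q.re := by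
    obtain ⟨q, hq⟩ := IsAlgClosed.exists_pow_nat_eq (1 + s ^ 2) (n := 2) (by norm_num)
    rcases le_total 0 q.re with h | h
    · exact ⟨q, hq, h⟩
    · exact ⟨-q, by rw [neg_sq, hq], by simpa using h⟩
  refine ⟨s + q, by linear_combination hq, by simpa using hre, fun hs => ?_⟩
  have h1 : ‖q - 1‖ * ‖q + 1‖ = ‖s‖ ^ 2 := by
    rw [← norm_mul, ← norm_pow]; congr 1; linear_combination hq
  have h2 : 1 ≤ ‖q + 1‖ := by
    have := Complex.re_le_norm (q + 1)
    simp only [Complex.add_re, Complex.one_re] at this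
    linarith
  have h3 : ‖q - 1‖ ≤ ‖s‖ ^ 2 := by nlinarith [norm_nonneg (q - 1)]
  calc ‖s + q - 1‖ = ‖s + (q - 1)‖ := by ring_nf
    _ ≤ ‖s‖ + ‖q - 1‖ := norm_add_le _ _
    _ ≤ 2 * ‖s‖ := by nlinarith [norm_nonneg s]

/-- Discrete variation of constants. It is applied to `y (n + 1) - z * y n`, where `z` is one
characteristic root and `ζ` is the other. -/
theorem norm_sub_pow_mul_le {x g : ℕ → ℂ} {ζ : ℂ} {M : ℝ} {m : ℕ} (hM : ∀ j < m, ‖ζ‖ ^ j ≤ M)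
    (hx : ∀ n < m, x (n + 1) = ζ * x n + 2 * g (n + 1)) :
    ‖x m - ζ ^ m * x 0‖ ≤ M * ∑ i ∈ Finset.range m, 2 * ‖g (i + 1)‖ := by
  have h : ∀ n ≤ m, x n - ζ ^ n * x 0 =
      ∑ i ∈ Finset.range n, ζ ^ (n - 1 - i) * (2 * g (i + 1)) := by
    intro n
    induction n with
    | zero => simp
    | succ n ih =>
      intro hn
      have h1 := ih (by omega)
      rw [Finset.sum_range_succ, hx n (by omega)]
      have h2 : ∑ i ∈ Finset.range n, ζ ^ (n + 1 - 1 - i) * (2 * g (i + 1)) =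
          ζ * ∑ i ∈ Finset.range n, ζ ^ (n - 1 - i) * (2 * g (i + 1)) := by
        rw [Finset.mul_sum]
        refine Finset.sum_congr rfl fun i hi => ?_
        rw [Finset.mem_range] at hi
        rw [show n + 1 - 1 - i = (n - 1 - i) + 1 by omega, pow_succ]
        ring
      rw [h2, ← h1]
      simp
      ring
  rw [h m le_rfl, Finset.mul_sum]
  refine (norm_sum_le _ _).trans (Finset.sum_le_sum fun i hi => ?_)
  rw [Finset.mem_range] at hi
  rw [norm_mul, norm_mul, norm_pow]
  simp only [Complex.norm_ofNat]
  exact mul_le_mul_of_nonneg_right (hM _ (by omega)) (by positivity)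

/-- The characteristic roots are `z` near `1` and `z' = -1/z` near `-1`. The factors `H = y (n + 1)
- z y n` and `K = y (n + 1) - z' y n` propagate with `z'` and `z`, and both start at `y 1` because
`y 0 = 0`. The final step makes the last `H` of order `|s|² |y N|` plus source; going back to `y 1`
and forward along `K` bounds `y N` by a small multiple of itself plus sources. `M` bounds the powers
of both roots. -/
theorem IsScalarBVM.norm_le_of_bounded {N : ℕ} {s : ℂ} {y g : ℕ → ℂ} (h : IsScalarBVM N s y g)
    (hN : 1 ≤ N) {M : ℝ} (hM : Real.exp (4 * (N * ‖s‖)) ≤ M) (hs : ‖s‖ ≤ 1 / 8)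
    (hsM : 16 * M ^ 2 * ‖s‖ ^ 2 ≤ 1) :
    ‖y N‖ ≤ 16 * M ^ 2 * ‖g N‖ +
      8 * M ^ 3 * ∑ i ∈ Finset.range (N - 1), 2 * ‖g (i + 1)‖ := by
  obtain ⟨z, hz, -, hz1⟩ := exists_root s
  replace hz1 := hz1 (by linarith)
  have hs0 := norm_nonneg s
  have hM1 : 1 ≤ M := le_trans (Real.one_le_exp (by positivity)) hM
  have hzu : ‖z‖ ≤ 1 + 2 * ‖s‖ := by
    have := norm_add_le (z - 1) 1
    rw [sub_add_cancel, norm_one] at this; linarith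
  have hzl : 1 - 2 * ‖s‖ ≤ ‖z‖ := by
    have := norm_sub_norm_le (1 : ℂ) (1 - z)
    rw [sub_sub_cancel, norm_one, norm_sub_rev] at this; linarith
  have hz0 : z ≠ 0 := by
    rw [← norm_pos_iff]; linarith
  set z' := 2 * s - z with hz'
  have hzz : z * z' = -1 := by rw [hz']; linear_combination -hz
  have hnzz : ‖z‖ * ‖z'‖ = 1 := by rw [← norm_mul, hzz]; simp
  have hz'u : ‖z'‖ ≤ 1 + 4 * ‖s‖ := by
    have h0 := norm_nonneg z'
    by_contra hcon
    push Not at hcon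
    nlinarith
  have hpow : ∀ {ζ : ℂ}, ‖ζ‖ ≤ 1 + 4 * ‖s‖ → ∀ j ≤ N, ‖ζ‖ ^ j ≤ M := by
    intro ζ hζ j hj
    refine le_trans ?_ hM
    calc ‖ζ‖ ^ j ≤ (Real.exp (4 * ‖s‖)) ^ j := by
          gcongr
          linarith [Real.add_one_le_exp (4 * ‖s‖)]
      _ = Real.exp (j * (4 * ‖s‖)) := by rw [← Real.exp_nat_mul]
      _ ≤ _ := by
          apply Real.exp_le_exp.mpr
          have : (j : ℝ) ≤ N := by exact_mod_cast hj
          nlinarith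
  have hpz : ∀ j ≤ N, ‖z‖ ^ j ≤ M := hpow (by linarith)
  have hpz' : ∀ j ≤ N, ‖z'‖ ^ j ≤ M := hpow hz'u
  obtain ⟨m, rfl⟩ : ∃ m, N = m + 1 := ⟨N - 1, by omega⟩
  have hf := h.final
  simp only [Nat.add_sub_cancel] at hf ⊢
  set G := ∑ i ∈ Finset.range m, 2 * ‖g (i + 1)‖ with hG
  have hG0 : 0 ≤ G := Finset.sum_nonneg fun i _ => by positivity
  have hH := norm_sub_pow_mul_le (x := fun n => y (n + 1) - z * y n) (g := g) (ζ := z') (M := M)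
    (m := m) (fun j hj => hpz' j (by omega)) (fun n hn => by
      rw [h.mid n (by omega)]
      linear_combination y n * hzz)
  have hK := norm_sub_pow_mul_le (x := fun n => y (n + 1) - z' * y n) (g := g) (ζ := z) (M := M)
    (m := m) (fun j hj => hpz j (by omega)) (fun n hn => by
      rw [h.mid n (by omega)]
      linear_combination y n * hzz)
  simp only [h.init, mul_zero, sub_zero, zero_add] at hH hK
  set Hm := y (m + 1) - z * y m with hHm
  set Km := y (m + 1) - z' * y m with hKm
  -- Since `z s = (z² - 1)/2`, backward Euler leaves the coefficient `1 - z + (z² - 1)/2`, which is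
  -- quadratically small in `s`.
  have hHe : Hm = (z - 1) ^ 2 / 2 * y (m + 1) + z * g (m + 1) := by
    rw [hHm]; linear_combination z * hf - y (m + 1) / 2 * hz
  have hHn : ‖Hm‖ ≤ 2 * ‖s‖ ^ 2 * ‖y (m + 1)‖ + 2 * ‖g (m + 1)‖ := by
    rw [hHe]
    refine (norm_add_le _ _).trans (add_le_add ?_ ?_)
    · rw [norm_mul, norm_div, norm_pow, Complex.norm_ofNat]
      gcongr
      nlinarith [norm_nonneg (z - 1)]
    · rw [norm_mul]
      gcongr
      linarith
  -- Backward propagation costs no more than forward propagation: `z z' = -1` makes `z'⁻ᵐ` equal to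
  -- `(-z)ᵐ`.
  have hy1 : ‖y 1‖ ≤ M * (‖Hm‖ + M * G) := by
    have e : y 1 = (-1) ^ m * (z ^ m * (z' ^ m * y 1)) := by
      rw [← mul_assoc (z ^ m), ← mul_pow, hzz, ← mul_assoc, ← mul_pow]; simp
    have e2 : ‖y 1‖ = ‖z‖ ^ m * ‖z' ^ m * y 1‖ := by
      conv_lhs => rw [e]
      rw [norm_mul, norm_mul, norm_pow, norm_pow]; simp
    rw [e2]
    gcongr
    · exact hpz m (by omega)
    · have := norm_sub_norm_le (z' ^ m * y 1) Hm
      rw [norm_sub_rev _ Hm] at this; linarith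
  have hKn : ‖Km‖ ≤ M * ‖y 1‖ + M * G := by
    have h1 := norm_sub_norm_le Km (z ^ m * y 1)
    have h2 : ‖z ^ m * y 1‖ ≤ M * ‖y 1‖ := by
      rw [norm_mul, norm_pow]; gcongr; exact hpz m (by omega)
    linarith
  have hcomb : 2 * (z - s) * y (m + 1) = z * Km - z' * Hm := by
    rw [hKm, hHm, hz']; ring
  have hyN : ‖y (m + 1)‖ ≤ 2 * ‖Km‖ + 2 * ‖Hm‖ := by
    have h1 : 1 / 2 ≤ ‖z - s‖ := by
      have := norm_sub_norm_le z s; linarith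
    have h2 : ‖2 * (z - s) * y (m + 1)‖ ≤ 2 * ‖Km‖ + 2 * ‖Hm‖ := by
      rw [hcomb]
      refine (norm_sub_le _ _).trans (add_le_add ?_ ?_) <;> rw [norm_mul] <;> gcongr <;> linarith
    rw [norm_mul, norm_mul, Complex.norm_ofNat] at h2
    nlinarith [norm_nonneg (y (m + 1))]
  have hH0 := norm_nonneg Hm
  have hM2 : 1 ≤ M ^ 2 := one_le_pow₀ hM1
  have hM3 : M ≤ M ^ 3 := by nlinarith
  have b1 : ‖y (m + 1)‖ ≤ 4 * M ^ 2 * ‖Hm‖ + 4 * M ^ 3 * G := by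
    have c1 : M * ‖y 1‖ ≤ M ^ 2 * ‖Hm‖ + M ^ 3 * G := by
      calc M * ‖y 1‖ ≤ M * (M * (‖Hm‖ + M * G)) := by gcongr
        _ = _ := by ring
    have c2 : M * G ≤ M ^ 3 * G := by gcongr
    have c3 : ‖Hm‖ ≤ M ^ 2 * ‖Hm‖ := le_mul_of_one_le_left hH0 hM2
    linarith
  -- `hsM` is used here: it leaves the coefficient `1/2` on `‖y (m + 1)‖`, to be absorbed on the
  -- left.
  have b2 : 4 * M ^ 2 * ‖Hm‖ ≤ 1 / 2 * ‖y (m + 1)‖ + 8 * M ^ 2 * ‖g (m + 1)‖ := by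
    calc 4 * M ^ 2 * ‖Hm‖ ≤ 4 * M ^ 2 * (2 * ‖s‖ ^ 2 * ‖y (m + 1)‖ + 2 * ‖g (m + 1)‖) := by gcongr
      _ = (16 * M ^ 2 * ‖s‖ ^ 2) * (1 / 2 * ‖y (m + 1)‖) + 8 * M ^ 2 * ‖g (m + 1)‖ := by ring
      _ ≤ 1 * (1 / 2 * ‖y (m + 1)‖) + 8 * M ^ 2 * ‖g (m + 1)‖ := by gcongr
      _ = _ := by ring
  linarith

/-- Stability of bounded modes. -/
theorem exists_stability_bounded (T B : ℝ) (hT : 0 < T) :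
    ∃ C : ℝ, 0 < C ∧ ∃ N₀ : ℕ, 1 ≤ N₀ ∧ ∀ N : ℕ, N₀ ≤ N → ∀ μ : ℂ, ‖μ‖ ≤ B → ∀ y g : ℕ → ℂ,
      IsScalarBVM N ((T / N : ℝ) * μ) y g →
      ‖y N‖ ^ 2 ≤ C * (N * ∑ n ∈ Finset.range (N - 1), ‖g (n + 1)‖ ^ 2 + ‖g N‖ ^ 2) := by
  set M := Real.exp (4 * (T * |B|)) with hM
  have hM0 : 0 < M := Real.exp_pos _
  obtain ⟨N₀, hN₀⟩ := exists_nat_ge (max (8 * (T * |B|)) (4 * M * (T * |B|)))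
  refine ⟨2 * (16 * M ^ 2) ^ 2 + 2 * (16 * M ^ 3) ^ 2, by positivity, max N₀ 1,
    le_max_right _ _, fun N hN μ hμ y g h => ?_⟩
  have hN1 : 1 ≤ N := (le_max_right _ _).trans hN
  have hNp : (0 : ℝ) < N := by exact_mod_cast hN1
  have hNr : (N₀ : ℝ) ≤ N := by exact_mod_cast (le_max_left _ _).trans hN
  have hs : ‖((T / N : ℝ) : ℂ) * μ‖ ≤ T * |B| / N := by
    rw [norm_mul, Complex.norm_real, Real.norm_of_nonneg (by positivity), div_mul_eq_mul_div]
    have := hμ.trans (le_abs_self B)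
    gcongr
  have h8 : T * |B| / N ≤ 1 / 8 := by
    rw [div_le_iff₀ hNp]; linarith [le_max_left (8 * (T * |B|)) (4 * M * (T * |B|))]
  have h4 : 4 * M * (T * |B| / N) ≤ 1 := by
    rw [← mul_div_assoc, div_le_one hNp]
    linarith [le_max_right (8 * (T * |B|)) (4 * M * (T * |B|))]
  have hb := h.norm_le_of_bounded hN1 (M := M) (by
      rw [hM]
      apply Real.exp_le_exp.mpr
      have := mul_le_mul_of_nonneg_left hs hNp.le
      rw [mul_div_cancel₀ _ hNp.ne'] at this
      linarith) (hs.trans h8) (by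
      have h0 : 4 * M * ‖((T / N : ℝ) : ℂ) * μ‖ ≤ 1 := le_trans (by gcongr) h4
      have h1 : (4 * M * ‖((T / N : ℝ) : ℂ) * μ‖) ^ 2 ≤ 1 := pow_le_one₀ (by positivity) h0
      linarith)
  set S := ∑ n ∈ Finset.range (N - 1), ‖g (n + 1)‖ with hS
  set Q := ∑ n ∈ Finset.range (N - 1), ‖g (n + 1)‖ ^ 2 with hQ
  have hQ0 : 0 ≤ Q := Finset.sum_nonneg fun _ _ => by positivity
  have hSQ : S ^ 2 ≤ N * Q := by
    refine sq_sum_le_card_mul_sum_sq.trans ?_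
    rw [Finset.card_range]
    gcongr
    omega
  rw [← Finset.mul_sum] at hb
  calc ‖y N‖ ^ 2 ≤ (16 * M ^ 2 * ‖g N‖ + 8 * M ^ 3 * (2 * S)) ^ 2 := by gcongr
    _ ≤ 2 * (16 * M ^ 2) ^ 2 * ‖g N‖ ^ 2 + 2 * (16 * M ^ 3) ^ 2 * S ^ 2 := by
        nlinarith [sq_nonneg (16 * M ^ 2 * ‖g N‖ - 8 * M ^ 3 * (2 * S))]
    _ ≤ 2 * (16 * M ^ 2) ^ 2 * ‖g N‖ ^ 2 + 2 * (16 * M ^ 3) ^ 2 * (N * Q) := by gcongr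
    _ ≤ _ := by
        have a1 : 0 ≤ 2 * (16 * M ^ 2) ^ 2 * (N * Q) := by positivity
        have a2 : 0 ≤ 2 * (16 * M ^ 3) ^ 2 * ‖g N‖ ^ 2 := by positivity
        linarith

/-- Here the energy estimate applies with `σ = T / N`; the factor `1/σ` is what produces the weight
`N` on the interior sources. -/
theorem exists_stability_re_neg (T : ℝ) (hT : 0 < T) :
    ∃ C : ℝ, 0 < C ∧ ∀ N : ℕ, 1 ≤ N → ∀ μ : ℂ, μ.re ≤ -1 → ∀ y g : ℕ → ℂ,
      IsScalarBVM N ((T / N : ℝ) * μ) y g →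
      ‖y N‖ ^ 2 ≤ C * (N * ∑ n ∈ Finset.range (N - 1), ‖g (n + 1)‖ ^ 2 + ‖g N‖ ^ 2) := by
  refine ⟨1 / T + 1, by positivity, fun N hN μ hμ y g h => ?_⟩
  have hNp : (0 : ℝ) < N := by exact_mod_cast hN
  have hb := h.norm_sq_le_of_re_neg hN (σ := T / N) (by positivity) (by
    rw [Complex.re_ofReal_mul]
    nlinarith [show 0 < T / N by positivity])
  have hQ0 : 0 ≤ ∑ n ∈ Finset.range (N - 1), ‖g (n + 1)‖ ^ 2 :=
    Finset.sum_nonneg fun _ _ => by positivity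
  refine hb.trans ?_
  rw [one_div_div, add_mul, one_mul]
  have : N / T * ∑ n ∈ Finset.range (N - 1), ‖g (n + 1)‖ ^ 2 =
    1 / T * (N * ∑ n ∈ Finset.range (N - 1), ‖g (n + 1)‖ ^ 2) := by ring
  rw [this]
  have a1 : 0 ≤ 1 / T * ‖g N‖ ^ 2 := by positivity
  have a2 : 0 ≤ N * ∑ n ∈ Finset.range (N - 1), ‖g (n + 1)‖ ^ 2 := by positivity
  linarith

/-! ### Singular parameters of the homogeneous scheme. -/

open Polynomial in
/-- The Fibonacci polynomials. -/
noncomputable def fibPoly : ℕ → ℤ[X]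
  | 0 => 0
  | 1 => 1
  | n + 2 => X * fibPoly (n + 1) + fibPoly n

open Polynomial in
theorem fibPoly_monic_degree (n : ℕ) :
    (fibPoly (n + 1)).Monic ∧ (fibPoly (n + 1)).degree = n ∧ (fibPoly n).degree < n := by
  induction n with
  | zero => simp [fibPoly, monic_one]
  | succ n ih =>
    obtain ⟨hm, hd, hd'⟩ := ih
    have hX : (X * fibPoly (n + 1)).degree = ((n + 1 : ℕ) : WithBot ℕ) := by
      rw [degree_mul, degree_X, hd, add_comm]; rfl
    have hlt : (fibPoly n).degree < (X * fibPoly (n + 1)).degree := by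
      rw [hX]; exact hd'.trans (by exact_mod_cast Nat.lt_succ_self n)
    refine ⟨(monic_X.mul hm).add_of_left hlt, ?_, ?_⟩
    · rw [show fibPoly (n + 1 + 1) = X * fibPoly (n + 1) + fibPoly n from rfl,
        degree_add_eq_left_of_degree_lt hlt, hX]
    · rw [hd]; exact_mod_cast Nat.lt_succ_self n

theorem IsScalarBVM.eq_fibPoly {N : ℕ} {s : ℂ} {y : ℕ → ℂ} (h : IsScalarBVM N s y 0) :
    ∀ n ≤ N, y n = Polynomial.aeval (2 * s) (fibPoly n) * y 1 := by
  intro n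
  induction n using Nat.strong_induction_on with
  | _ n ih =>
    intro hn
    match n, ih, hn with
    | 0, _, _ => simp [h.init, fibPoly]
    | 1, _, _ => simp [fibPoly]
    | n + 2, ih, hn =>
      rw [h.mid n hn, ih n (by omega) (by omega), ih (n + 1) (by omega) (by omega), fibPoly]
      simp
      ring

/-- The homogeneous scheme has a nontrivial solution. -/
def IsSingular (N : ℕ) (s : ℂ) : Prop :=
  ∃ y : ℕ → ℂ, IsScalarBVM N s y 0 ∧ y 1 ≠ 0

-- With `y 0 = 0` the recurrence gives `y n = Fₙ(2s) y 1`, and twice the final condition reads `X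
-- F_N + 2 (F_{N-1} - F_N) = 0` at `X = 2s`. This polynomial is monic with integer coefficients; the
-- doubling removes the denominator of `s = (2s)/2`.
open Polynomial in
theorem IsSingular.isIntegral {N : ℕ} {s : ℂ} (hN : 1 ≤ N) (h : IsSingular N s) :
    IsIntegral ℤ (2 * s) := by
  obtain ⟨y, hy, hy1⟩ := h
  obtain ⟨m, rfl⟩ : ∃ m, N = m + 1 := ⟨N - 1, by omega⟩
  obtain ⟨hm, hd, hd'⟩ := fibPoly_monic_degree m
  have hX : (X * fibPoly (m + 1)).degree = ((m + 1 : ℕ) : WithBot ℕ) := by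
    rw [degree_mul, degree_X, hd, add_comm]; rfl
  have hlt : (C (2 : ℤ) * (fibPoly m - fibPoly (m + 1))).degree <
      (X * fibPoly (m + 1)).degree := by
    rw [hX, degree_C_mul (by norm_num)]
    refine (degree_sub_le _ _).trans_lt (max_lt (hd'.trans ?_) ?_)
    · exact_mod_cast Nat.lt_succ_self m
    · rw [hd]; exact_mod_cast Nat.lt_succ_self m
  refine ⟨X * fibPoly (m + 1) + C (2 : ℤ) * (fibPoly m - fibPoly (m + 1)),
    (monic_X.mul hm).add_of_left hlt, ?_⟩
  rw [← aeval_def]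
  have hf := hy.final
  rw [Nat.add_sub_cancel, hy.eq_fibPoly (m + 1) le_rfl, hy.eq_fibPoly m (by omega)] at hf
  refine mul_right_cancel₀ hy1 ?_
  simp only [map_add, map_mul, aeval_X, map_sub, aeval_C, Pi.zero_apply] at hf ⊢
  simp only [eq_intCast, Int.cast_ofNat]
  linear_combination -2 * hf

/-- The recurrence runs backwards: `y N = 0` forces `y (N - 1) = 0` through backward Euler, and two
consecutive zeros propagate down. -/
theorem IsScalarBVM.eq_zero_of_final {N : ℕ} {s : ℂ} {y : ℕ → ℂ} (h : IsScalarBVM N s y 0)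
    (hN : 1 ≤ N) (hy : y N = 0) : y 1 = 0 := by
  have hd : ∀ j, j + 1 ≤ N → y (N - j) = 0 ∧ y (N - j - 1) = 0 := by
    intro j
    induction j with
    | zero =>
      intro _
      have hf := h.final
      simp only [hy, mul_zero, Pi.zero_apply, add_zero] at hf
      exact ⟨hy, hf.symm⟩
    | succ j ih =>
      intro hj
      obtain ⟨h1, h2⟩ := ih (by omega)
      refine ⟨h2, ?_⟩
      have hm := h.mid (N - (j + 1) - 1) (by omega)
      rw [show N - (j + 1) - 1 + 2 = N - j by omega, show N - (j + 1) - 1 + 1 = N - j - 1 by omega,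
        h1, h2] at hm
      simpa using hm.symm
  have := (hd (N - 1) (by omega)).1
  rwa [show N - (N - 1) = 1 by omega] at this

theorem IsScalarBVM.eq_zero {N : ℕ} {s : ℂ} {y : ℕ → ℂ} (h : IsScalarBVM N s y 0)
    (hs : ¬ IsSingular N s) : ∀ n ≤ N, y n = 0 := by
  have h1 : y 1 = 0 := by
    by_contra hne
    exact hs ⟨y, h, hne⟩
  intro n hn
  rw [h.eq_fibPoly n hn, h1, mul_zero]

theorem not_isSingular_zero {N : ℕ} (hN : 1 ≤ N) : ¬ IsSingular N 0 := by
  rintro ⟨y, hy, hy1⟩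
  refine hy1 (hy.eq_zero_of_final hN ?_)
  have := hy.norm_le_of_bounded hN (M := 1) (by simp) (by simp) (by simp)
  simpa using this

/-- The dominant root has `|z| ≥ 1 + η/2` and the other has modulus at most `1`. A nontrivial
solution would need `(z - z') z'ᵐ = (z - 1)²/2 · (zᵐ⁺¹ - z'ᵐ⁺¹)` with `m = N - 1`. The left side is
at most `2|z|`; by Bernoulli the right side is at least `|z| m η³/16`, whence the constant `32`. -/
theorem not_isSingular_of_le_re {N : ℕ} {s : ℂ} {η : ℝ} (hη : 0 < η) (hs : η ≤ (2 * s).re)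
    (hN : 1 ≤ N) (hNη : 32 < (N - 1 : ℕ) * η ^ 3) : ¬ IsSingular N s := by
  rintro ⟨y, h, hy1⟩
  obtain ⟨z, hz, hzre, -⟩ := exists_root s
  obtain ⟨m, rfl⟩ : ∃ m, N = m + 1 := ⟨N - 1, by omega⟩
  have hs0 : 0 < s.re := by
    simp only [Complex.mul_re, Complex.re_ofNat, Complex.im_ofNat, zero_mul, sub_zero] at hs
    linarith
  have hzp : 0 < z.re := by linarith
  have hz0 : z ≠ 0 := by rintro rfl; simp at hzp
  set z' := 2 * s - z with hz'
  have hzz : z * z' = -1 := by rw [hz']; linear_combination -hz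
  set ρ := ‖z‖ with hρ
  have hρ0 : 0 < ρ := norm_pos_iff.mpr hz0
  have hnzz : ρ * ‖z'‖ = 1 := by rw [hρ, ← norm_mul, hzz]; simp
  -- Real part of `2s = z - 1/z`, multiplied by `|z|²`.
  have hre : (2 * s).re * ρ ^ 2 = z.re * (ρ ^ 2 - 1) := by
    have e : (2 * s) * ((ρ ^ 2 : ℝ) : ℂ) = z * ((ρ ^ 2 : ℝ) : ℂ) - (starRingEnd ℂ) z := by
      have hn : ((ρ ^ 2 : ℝ) : ℂ) = z * (starRingEnd ℂ) z := by
        rw [Complex.mul_conj, Complex.normSq_eq_norm_sq]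
      rw [hn]
      linear_combination (-(starRingEnd ℂ) z) * hz
    have := congrArg Complex.re e
    rw [Complex.re_mul_ofReal, Complex.sub_re, Complex.re_mul_ofReal, Complex.conj_re] at this
    linarith
  have hρ1 : 1 < ρ := by
    have h1 : 0 < z.re * (ρ ^ 2 - 1) := by
      rw [← hre]; exact mul_pos (by linarith) (by positivity)
    have h2 := (pos_iff_pos_of_mul_pos h1).mp hzp
    nlinarith
  have hρη : 1 + η / 2 ≤ ρ := by
    have h1 : z.re ≤ ρ := Complex.re_le_norm z
    have h2 : η * ρ ^ 2 ≤ ρ * (ρ ^ 2 - 1) := by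
      calc η * ρ ^ 2 ≤ (2 * s).re * ρ ^ 2 := by gcongr
        _ = z.re * (ρ ^ 2 - 1) := hre
        _ ≤ _ := mul_le_mul_of_nonneg_right h1 (by nlinarith)
    have h3 : η * ρ ≤ ρ ^ 2 - 1 := by
      by_contra hc
      push Not at hc
      nlinarith
    by_contra hc
    push Not at hc
    nlinarith
  have hz'1 : ‖z'‖ ≤ 1 := by
    by_contra hc
    push Not at hc
    nlinarith
  have hH := norm_sub_pow_mul_le (x := fun n => y (n + 1) - z * y n) (g := 0) (ζ := z') (M := 1)
    (m := m) (fun j hj => pow_le_one₀ (norm_nonneg _) hz'1) (fun n hn => by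
      rw [h.mid n (by omega)]
      linear_combination y n * hzz)
  have hK := norm_sub_pow_mul_le (x := fun n => y (n + 1) - z' * y n) (g := 0) (ζ := z)
    (M := ρ ^ m) (m := m) (fun j hj => pow_le_pow_right₀ hρ1.le hj.le) (fun n hn => by
      rw [h.mid n (by omega)]
      linear_combination y n * hzz)
  simp only [h.init, mul_zero, sub_zero, zero_add, Pi.zero_apply, norm_zero,
    Finset.sum_const_zero, norm_le_zero_iff, sub_eq_zero] at hH hK
  have hf := h.final
  simp only [Nat.add_sub_cancel, Pi.zero_apply, add_zero] at hf hNη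
  have hHe : y (m + 1) - z * y m = (z - 1) ^ 2 / 2 * y (m + 1) := by
    linear_combination z * hf - y (m + 1) / 2 * hz
  have e1 : (z - z') * z' ^ m = (z - 1) ^ 2 / 2 * (z * z ^ m - z' * z' ^ m) := by
    refine mul_right_cancel₀ hy1 ?_
    linear_combination (z - z') * (hHe - hH) + (z - 1) ^ 2 / 2 * (z * hK - z' * hH)
  have e2 := congrArg norm e1
  simp only [norm_mul, norm_pow, norm_div, Complex.norm_ofNat] at e2
  have b1 : ‖z - z'‖ * ‖z'‖ ^ m ≤ 2 * ρ := by
    have : ‖z - z'‖ ≤ ρ + 1 := (norm_sub_le _ _).trans (by linarith)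
    calc ‖z - z'‖ * ‖z'‖ ^ m ≤ (ρ + 1) * 1 := by
          gcongr
          exact pow_le_one₀ (norm_nonneg _) hz'1
      _ ≤ _ := by linarith
  have b2 : η / 2 ≤ ‖z - 1‖ := by
    have := norm_sub_norm_le z 1
    rw [norm_one] at this; linarith
  have b3 : ρ * (m * (η / 2)) ≤ ‖z * z ^ m - z' * z' ^ m‖ := by
    have h1 := norm_sub_norm_le (z * z ^ m) (z' * z' ^ m)
    have h2 : ‖z' * z' ^ m‖ ≤ 1 := by
      rw [← pow_succ', norm_pow]; exact pow_le_one₀ (norm_nonneg _) hz'1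
    have h3 : 1 + m * (η / 2) ≤ ρ ^ m :=
      (one_add_mul_le_pow (by linarith) m).trans (by gcongr)
    have h4 : ρ * (1 + m * (η / 2)) ≤ ρ * ρ ^ m := by gcongr
    rw [norm_mul, norm_pow] at h1
    linarith
  have b4 : (η / 2) ^ 2 / 2 * (ρ * (m * (η / 2))) ≤ 2 * ρ := by
    refine le_trans ?_ (e2.symm.le.trans b1)
    gcongr
  have b5 : ρ * (m * η ^ 3) ≤ ρ * 32 := by linarith
  exact absurd (le_of_mul_le_mul_left b5 hρ0) (by linarith)

/-! ### Arithmetic of the spurious modes. -/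

/-- In the number field `ℚ(a, b)` every conjugate of `(a + b k)/N` is at most `M (1 + k)/N < 1` in
modulus. The norm of an algebraic integer is a rational integer, so here it is zero. -/
theorem exists_eq_zero_of_isIntegral {a b : ℂ} (ha : IsAlgebraic ℚ a) (hb : IsAlgebraic ℚ b) :
    ∃ M : ℝ, 0 < M ∧ ∀ N k : ℕ, 1 ≤ N → M * (1 + k) < N →
      IsIntegral ℤ ((a + b * k) / N) → (a + b * k) / N = 0 := by
  let K := IntermediateField.adjoin ℚ ({a, b} : Set ℂ)
  have hfin : FiniteDimensional ℚ K := by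
    refine IntermediateField.finiteDimensional_adjoin fun x hx => ?_
    rcases hx with rfl | rfl
    · exact ha.isIntegral
    · exact hb.isIntegral
  let a' : K := ⟨a, IntermediateField.subset_adjoin ℚ _ (by simp)⟩
  let b' : K := ⟨b, IntermediateField.subset_adjoin ℚ _ (by simp)⟩
  refine ⟨∑ σ : K →ₐ[ℚ] ℂ, (‖σ a'‖ + ‖σ b'‖) + 1, by positivity, fun N k hN hM hint => ?_⟩
  set M := ∑ σ : K →ₐ[ℚ] ℂ, (‖σ a'‖ + ‖σ b'‖) + 1 with hMdef
  have hNp : (0 : ℝ) < N := by exact_mod_cast hN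
  let x : K := (a' + b' * k) / N
  have hx : algebraMap K ℂ x = (a + b * k) / N := by simp [x, a', b']
  rw [← hx] at hint ⊢
  have hxi : IsIntegral ℤ x := (isIntegral_algebraMap_iff (algebraMap K ℂ).injective).mp hint
  have hσ : ∀ σ : K →ₐ[ℚ] ℂ, ‖σ x‖ ≤ M * (1 + k) / N := by
    intro σ
    have h1 : σ x = (σ a' + σ b' * k) / N := by simp [x]
    rw [h1, norm_div, Complex.norm_natCast]
    gcongr
    have h2 : ‖σ a'‖ + ‖σ b'‖ ≤ M := by
      have := Finset.single_le_sum (f := fun σ : K →ₐ[ℚ] ℂ => ‖σ a'‖ + ‖σ b'‖)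
        (fun _ _ => by positivity) (Finset.mem_univ σ)
      linarith
    have hk : (0 : ℝ) ≤ k := Nat.cast_nonneg k
    calc ‖σ a' + σ b' * k‖ ≤ ‖σ a'‖ + ‖σ b'‖ * k := by
          refine (norm_add_le _ _).trans ?_
          rw [norm_mul, Complex.norm_natCast]
      _ ≤ (‖σ a'‖ + ‖σ b'‖) * (1 + k) := by nlinarith [norm_nonneg (σ a'), norm_nonneg (σ b')]
      _ ≤ _ := by gcongr
  have hlt : M * (1 + k) / N < 1 := by rwa [div_lt_one hNp]
  obtain ⟨n, hn⟩ := IsIntegrallyClosed.isIntegral_iff.mp (Algebra.isIntegral_norm ℚ hxi)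
  have hprod : ‖algebraMap ℚ ℂ (Algebra.norm ℚ x)‖ < 1 := by
    rw [Algebra.norm_eq_prod_embeddings ℚ ℂ x, norm_prod]
    refine (Finset.prod_le_prod (fun _ _ => norm_nonneg _) fun σ _ => hσ σ).trans_lt ?_
    rw [Finset.prod_const]
    have : Nonempty (K →ₐ[ℚ] ℂ) := ⟨K.val⟩
    exact pow_lt_one₀ (by positivity) hlt (by rw [Finset.card_univ]; exact Fintype.card_ne_zero)
  have hn0 : n = 0 := by
    rw [← hn] at hprod
    simp only [eq_intCast, map_intCast, Complex.norm_intCast] at hprod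
    have : |n| < 1 := by exact_mod_cast hprod
    exact Int.abs_lt_one_iff.mp this
  rw [hn0, map_zero] at hn
  rw [Algebra.norm_eq_zero_iff.mp hn.symm, map_zero]

theorem isAlgebraic_of_isIntegral_div {w : ℂ} {N : ℕ} (hN : 1 ≤ N) (h : IsIntegral ℤ (w / N)) :
    IsAlgebraic ℚ w := by
  have hN0 : (N : ℂ) ≠ 0 := by exact_mod_cast (by omega : N ≠ 0)
  have h1 : IsAlgebraic ℚ (w / N) := (h.tower_top (A := ℚ)).isAlgebraic
  have h2 : IsAlgebraic ℚ (N : ℂ) := isAlgebraic_natCast N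
  have := h1.mul h2
  rwa [div_mul_cancel₀ _ hN0] at this

/-- For large `N`, the scheme is uniquely solvable on every mode of an arithmetic progression. -/
theorem exists_not_isSingular (a b : ℂ) (hb : 0 < b.re) :
    ∃ N₀ : ℕ, 1 ≤ N₀ ∧ ∀ N, N₀ ≤ N → ∀ k : ℕ, ¬ IsSingular N ((a + b * k) / N / 2) := by
  have hint : ∀ {N k : ℕ}, 1 ≤ N → IsSingular N ((a + b * k) / N / 2) →
      IsIntegral ℤ ((a + b * k) / N) := by
    intro N k hN h
    have := h.isIntegral hN
    rwa [mul_div_cancel₀ _ (two_ne_zero' ℂ)] at this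
  by_cases halg : IsAlgebraic ℚ a ∧ IsAlgebraic ℚ b
  · obtain ⟨M, hM, hMz⟩ := exists_eq_zero_of_isIntegral halg.1 halg.2
    -- With this `η`, a real part below `η` gives `M k < N/2 + M |a.re| / b.re`, and the choice of
    -- `N₀` then yields `M (1 + k) < N`.
    set η := b.re / (2 * M) with hη
    have hη0 : 0 < η := by positivity
    obtain ⟨N₀, hN₀⟩ := exists_nat_gt (max (2 * (M + M * |a.re| / b.re)) (32 / η ^ 3))
    refine ⟨N₀ + 1, by omega, fun N hN k hs => ?_⟩
    have hN1 : 1 ≤ N := by omega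
    have hNp : (0 : ℝ) < N := by exact_mod_cast hN1
    have hNr : (N₀ : ℝ) ≤ (N - 1 : ℕ) := by exact_mod_cast (by omega : N₀ ≤ N - 1)
    have hNr' : (N₀ : ℝ) ≤ N := by exact_mod_cast (by omega : N₀ ≤ N)
    have hre : (2 * ((a + b * k) / N / 2)).re < η := by
      by_contra hc
      push Not at hc
      refine not_isSingular_of_le_re hη0 hc hN1 ?_ hs
      have h1 : 32 / η ^ 3 < (N - 1 : ℕ) := (le_max_right _ _).trans_lt (hN₀.trans_le hNr)
      rwa [div_lt_iff₀ (by positivity)] at h1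
    rw [mul_div_cancel₀ _ (two_ne_zero' ℂ), Complex.div_natCast_re, div_lt_iff₀ hNp] at hre
    have hre2 : a.re + b.re * k < η * N := by simpa using hre
    have h2 : 2 * (M + M * |a.re| / b.re) < N := (le_max_left _ _).trans_lt (hN₀.trans_le hNr')
    have h3 : M * (1 + k) < N := by
      have h4 : b.re * k < η * N + |a.re| := by linarith [neg_abs_le a.re]
      have h5 : M / b.re * (b.re * k) < M / b.re * (η * N + |a.re|) := by gcongr
      have h6 : M / b.re * (b.re * k) = M * k := by field_simp
      have h7 : M / b.re * (η * N + |a.re|) = N / 2 + M * |a.re| / b.re := by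
        rw [hη]; field_simp
      linarith
    have h0 := hMz N k hN1 h3 (hint hN1 hs)
    rw [h0, zero_div] at hs
    exact not_isSingular_zero hN1 hs
  -- Two distinct indices with `a + b k` algebraic would make `b`, and then `a`, algebraic. So the
  -- singular `k` is unique across all `N`, and it is a fixed, bounded mode.
  · have huniq : ∀ {N N' k k' : ℕ}, 1 ≤ N → 1 ≤ N' → IsSingular N ((a + b * k) / N / 2) →
        IsSingular N' ((a + b * k') / N' / 2) → k = k' := by
      intro N N' k k' hN hN' h h'
      by_contra hne
      refine halg ?_
      have h1 := isAlgebraic_of_isIntegral_div hN (hint hN h)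
      have h2 := isAlgebraic_of_isIntegral_div hN' (hint hN' h')
      have hd : ((k : ℂ) - k') ≠ 0 := by
        rw [sub_ne_zero]; exact_mod_cast hne
      have hk : IsAlgebraic ℚ (k : ℂ) := isAlgebraic_natCast k
      have hk' : IsAlgebraic ℚ (k' : ℂ) := isAlgebraic_natCast k'
      have hb' : IsAlgebraic ℚ b := by
        have e : b = ((a + b * k) - (a + b * k')) * ((k : ℂ) - k')⁻¹ := by
          rw [eq_mul_inv_iff_mul_eq₀ hd]; ring
        rw [e]
        exact (h1.sub h2).mul (hk.sub hk').inv
      refine ⟨?_, hb'⟩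
      have e : a = (a + b * k) - b * k := by ring
      rw [e]
      exact h1.sub (hb'.mul hk)
    by_cases hex : ∃ N k : ℕ, 1 ≤ N ∧ IsSingular N ((a + b * k) / N / 2)
    · obtain ⟨N₁, k₀, hN₁, hs₁⟩ := hex
      obtain ⟨C, -, N₀, hN₀, hC⟩ :=
        exists_stability_bounded 1 ‖(a + b * k₀) / 2‖ one_pos
      refine ⟨N₀, hN₀, fun N hN k hs => ?_⟩
      have hN1 : 1 ≤ N := hN₀.trans hN
      obtain rfl := huniq hN1 hN₁ hs hs₁
      obtain ⟨y, hy, hy1⟩ := hs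
      refine hy1 (hy.eq_zero_of_final hN1 ?_)
      have e : (a + b * k) / N / 2 = ((1 / N : ℝ) : ℂ) * ((a + b * k) / 2) := by
        push_cast; ring
      have := hC N hN _ le_rfl y 0 (e ▸ hy)
      simpa using this
    · push Not at hex
      exact ⟨1, le_rfl, fun N hN k => hex N k hN⟩

/-! ### The Dirichlet integral. -/

/-- The Dirichlet kernel `1 + 2 ∑ cos (2 k t)`. -/
noncomputable def dirichletKernel (n : ℕ) (t : ℝ) : ℝ :=
  1 + ∑ k ∈ Finset.range n, 2 * Real.cos (2 * (k + 1) * t)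

theorem sin_mul_dirichletKernel (n : ℕ) (t : ℝ) :
    Real.sin t * dirichletKernel n t = Real.sin ((2 * n + 1) * t) := by
  induction n with
  | zero => simp [dirichletKernel]
  | succ n ih =>
    have h : dirichletKernel (n + 1) t =
        dirichletKernel n t + 2 * Real.cos (2 * (n + 1) * t) := by
      simp only [dirichletKernel, Finset.sum_range_succ]; ring
    rw [h, mul_add, ih]
    push_cast
    have e1 : (2 * ((n : ℝ) + 1) + 1) * t = 2 * (n + 1) * t + t := by ring
    have e2 : (2 * (n : ℝ) + 1) * t = 2 * (n + 1) * t - t := by ring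
    rw [e1, e2, Real.sin_add, Real.sin_sub]
    ring

theorem continuous_dirichletKernel (n : ℕ) : Continuous (dirichletKernel n) := by
  unfold dirichletKernel; fun_prop

theorem integral_dirichletKernel (n : ℕ) :
    ∫ t in (0 : ℝ)..Real.pi / 2, dirichletKernel n t = Real.pi / 2 := by
  unfold dirichletKernel
  rw [intervalIntegral.integral_add (by simp)
    (Continuous.intervalIntegrable (by fun_prop) _ _), intervalIntegral.integral_finsetSum
    fun i _ => Continuous.intervalIntegrable (by fun_prop) _ _]
  rw [Finset.sum_eq_zero]
  · simp
  · intro k _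
    have hk : (2 * ((k : ℝ) + 1)) ≠ 0 := by positivity
    rw [intervalIntegral.integral_const_mul,
      intervalIntegral.integral_comp_mul_left (fun x => Real.cos x) hk, integral_cos]
    have : 2 * ((k : ℝ) + 1) * (Real.pi / 2) = ((k + 1 : ℕ) : ℝ) * Real.pi := by push_cast; ring
    rw [this, Real.sin_nat_mul_pi]
    simp

/-- Riemann–Lebesgue: up to sign, this is the imaginary part of the Fourier transform of the
truncated function at `w / (2π)`. -/
theorem tendsto_integral_sin_mul {a b : ℝ} {h : ℝ → ℝ} (hab : a ≤ b)
    (hi : IntervalIntegrable h volume a b) :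
    Tendsto (fun w : ℝ => ∫ t in a..b, Real.sin (w * t) * h t) atTop (𝓝 0) := by
  have h1 := Real.tendsto_integral_exp_smul_cocompact
    ((Ioc a b).indicator fun t => (h t : ℂ))
  have h2 : Tendsto (fun w : ℝ => w / (2 * Real.pi)) atTop (cocompact ℝ) :=
    (tendsto_id.atTop_div_const (by positivity)).mono_right atTop_le_cocompact
  have h3 := ((Complex.continuous_im.tendsto 0).comp (h1.comp h2)).neg
  simp only [Complex.zero_im, neg_zero] at h3
  refine h3.congr fun w => ?_
  simp only [Function.comp_apply]
  have e : (fun v : ℝ => Real.fourierChar (-(v * (w / (2 * Real.pi)))) •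
      (Ioc a b).indicator (fun t => (h t : ℂ)) v) =
      (Ioc a b).indicator fun t => Complex.exp ((-(w * t) : ℝ) * Complex.I) * h t := by
    ext v
    by_cases hv : v ∈ Ioc a b
    · simp only [indicator_of_mem hv, Circle.smul_def, Real.fourierChar_apply, smul_eq_mul]
      congr 4
      field_simp
    · simp [indicator_of_notMem hv]
  rw [e, integral_indicator measurableSet_Ioc, intervalIntegral.integral_of_le hab]
  have hint : Integrable (fun t => Complex.exp ((-(w * t) : ℝ) * Complex.I) * h t)
      (volume.restrict (Ioc a b)) := by
    refine Integrable.bdd_mul (c := 1)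
      ((intervalIntegrable_iff_integrableOn_Ioc_of_le hab).mp hi).ofReal
      (by fun_prop) (ae_of_all _ fun t => ?_)
    rw [Complex.norm_exp_ofReal_mul_I]
  have him := integral_im hint
  simp only [RCLike.im_to_complex] at him
  rw [← him, ← integral_neg]
  refine integral_congr_ae (ae_of_all _ fun t => ?_)
  simp only [Complex.im_mul_ofReal, Complex.exp_ofReal_mul_I_im, Real.sin_neg]
  ring

/-- The singularity at `0` is removable: `1 - sinc t ≤ t²/6`, while Jordan's inequality gives `sin t
≥ 2t/π`. -/
theorem intervalIntegrable_one_sub_sinc_div_sin :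
    IntervalIntegrable (fun t => (1 - Real.sinc t) / Real.sin t) volume 0 (Real.pi / 2) := by
  rw [intervalIntegrable_iff_integrableOn_Ioc_of_le (by positivity)]
  refine Measure.integrableOn_of_bounded (M := Real.pi ^ 2) (by simp) (by
    have := Real.continuous_sinc.measurable
    exact (by fun_prop : Measurable _).aestronglyMeasurable) ?_
  filter_upwards [ae_restrict_mem measurableSet_Ioc] with t ht
  have hp := Real.pi_gt_three
  have hs := Real.mul_le_sin ht.1.le ht.2
  have hs0 : 0 < 2 / Real.pi * t := mul_pos (by positivity) ht.1
  have h1 : 1 - Real.sinc t ≤ t ^ 2 / 6 := by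
    rw [Real.sinc_of_ne_zero ht.1.ne', sub_le_comm, le_div_iff₀ ht.1]
    linarith [Real.sin_gt_sub_cube ht.1]
  have h0 : 0 ≤ 1 - Real.sinc t := sub_nonneg.mpr (Real.sinc_le_one t)
  rw [Real.norm_of_nonneg (div_nonneg h0 (by linarith)), div_le_iff₀ (by linarith)]
  calc 1 - Real.sinc t ≤ t ^ 2 / 6 := h1
    _ ≤ Real.pi ^ 2 * (2 / Real.pi * t) := by
      have : Real.pi ^ 2 * (2 / Real.pi * t) = 2 * Real.pi * t := by field_simp
      rw [this]
      nlinarith [ht.1, ht.2]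
    _ ≤ _ := by gcongr

/-- The Dirichlet integral `∫₀^∞ sin t / t = π / 2`, along a sequence. -/
theorem tendsto_integral_sinc :
    Tendsto (fun n : ℕ => ∫ t in (0 : ℝ)..(2 * n + 1) * (Real.pi / 2), Real.sinc t) atTop
      (𝓝 (Real.pi / 2)) := by
  -- With `m = 2n + 1` and `D` the Dirichlet kernel, `m sinc (m t) = D sinc t = D - sin (m t) (1 -
  -- sinc t) / sin t`. The kernel integrates to `π/2` and the remainder tends to zero.
  have h := tendsto_integral_sin_mul (by positivity) intervalIntegrable_one_sub_sinc_div_sin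
  have hn : Tendsto (fun n : ℕ => 2 * (n : ℝ) + 1) atTop atTop :=
    tendsto_atTop_add_const_right _ _
      (tendsto_natCast_atTop_atTop.const_mul_atTop (by norm_num))
  have h2 := (h.comp hn).const_sub (Real.pi / 2)
  rw [sub_zero] at h2
  refine h2.congr fun n => ?_
  have hm : (2 * (n : ℝ) + 1) ≠ 0 := by positivity
  simp only [Function.comp_apply]
  have hi1 : IntervalIntegrable (fun t => Real.sin ((2 * n + 1) * t) *
      ((1 - Real.sinc t) / Real.sin t)) volume 0 (Real.pi / 2) :=
    intervalIntegrable_one_sub_sinc_div_sin.continuousOn_mul (by fun_prop)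
  have e2 := intervalIntegral.mul_integral_comp_mul_left (f := Real.sinc) (a := 0)
    (b := Real.pi / 2) (c := 2 * n + 1)
  rw [mul_zero] at e2
  have e3 := intervalIntegral.integral_sub
    ((continuous_dirichletKernel n).intervalIntegrable 0 (Real.pi / 2)) hi1
  rw [integral_dirichletKernel] at e3
  rw [← e2, ← intervalIntegral.integral_const_mul, ← e3]
  refine intervalIntegral.integral_congr_ae (ae_of_all _ fun t ht => ?_)
  rw [uIoc_of_le (by positivity)] at ht
  have hs : Real.sin t ≠ 0 :=
    (Real.sin_pos_of_pos_of_lt_pi ht.1 (by linarith [ht.2, Real.pi_pos])).ne'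
  have ht0 := ht.1.ne'
  rw [Real.sinc_of_ne_zero ht0, Real.sinc_of_ne_zero (mul_ne_zero hm ht0),
    ← sin_mul_dirichletKernel]
  field_simp
  ring

/-! ### The Hilbert transform on waves. -/

/-- The real wave with frequency `κ` and phase `θ`. -/
noncomputable def wave (κ θ : ℝ) (y : ℝ) : ℝ := Real.cos (κ * y - θ)

theorem deriv_wave (κ θ : ℝ) : deriv (wave κ θ) = fun y => -κ * Real.sin (κ * y - θ) := by
  ext y
  have h : HasDerivAt (wave κ θ) (-Real.sin (κ * y - θ) * (κ * 1)) y :=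
    (((hasDerivAt_id y).const_mul κ).sub_const θ).cos
  rw [h.deriv]
  ring

theorem deriv_deriv_wave (κ θ : ℝ) :
    deriv (deriv (wave κ θ)) = fun y => -κ ^ 2 * wave κ θ y := by
  ext y
  have h : HasDerivAt (fun y => -κ * Real.sin (κ * y - θ))
      (-κ * (Real.cos (κ * y - θ) * (κ * 1))) y :=
    (((hasDerivAt_id y).const_mul κ).sub_const θ).sin.const_mul _
  rw [deriv_wave, h.deriv, wave]
  ring

/-- Substituting `y = x ∓ t` folds the two sides of the annulus together; the sines at `κx - θ ∓ κt`
combine so that only the even part `2κ cos (κx - θ) sin (κt)/t` survives. -/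
theorem integral_deriv_wave_div {κ θ x r R : ℝ} (hκ : 0 < κ) (hr : 0 < r) (hR : r < R) :
    ∫ y in {y : ℝ | r < |x - y| ∧ |x - y| < R}, deriv (wave κ θ) y / (x - y) =
      2 * κ * wave κ θ x *
        ((∫ t in (0 : ℝ)..κ * R, Real.sinc t) - ∫ t in (0 : ℝ)..κ * r, Real.sinc t) := by
  have hS : {y : ℝ | r < |x - y| ∧ |x - y| < R} =
      Ioo (x - R) (x - r) ∪ Ioo (x + r) (x + R) := by
    ext y
    simp only [mem_ofPred_eq, mem_union, mem_Ioo]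
    rcases le_total 0 (x - y) with h | h
    · rw [abs_of_nonneg h]
      constructor
      · rintro ⟨h1, h2⟩; left; constructor <;> linarith
      · rintro (⟨h1, h2⟩ | ⟨h1, h2⟩) <;> constructor <;> linarith
    · rw [abs_of_nonpos h]
      constructor
      · rintro ⟨h1, h2⟩; right; constructor <;> linarith
      · rintro (⟨h1, h2⟩ | ⟨h1, h2⟩) <;> constructor <;> linarith
  set F : ℝ → ℝ := fun y => deriv (wave κ θ) y / (x - y) with hF
  have hcont : ∀ {a b : ℝ}, x ∉ Icc a b → ContinuousOn F (Icc a b) := by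
    intro a b hx
    rw [hF, deriv_wave]
    refine ContinuousOn.div (by fun_prop) (by fun_prop) fun y hy h0 => hx ?_
    rw [sub_eq_zero.mp h0]; exact hy
  have hc1 : ContinuousOn F (Icc (x - R) (x - r)) := hcont fun h => by linarith [h.2]
  have hc2 : ContinuousOn F (Icc (x + r) (x + R)) := hcont fun h => by linarith [h.1]
  rw [hS, setIntegral_union]
  rotate_left
  · rw [Set.disjoint_left]
    rintro y ⟨_, h1⟩ ⟨h2, _⟩
    linarith
  · exact measurableSet_Ioo
  · exact hc1.integrableOn_Icc.mono_set Ioo_subset_Icc_self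
  · exact hc2.integrableOn_Icc.mono_set Ioo_subset_Icc_self
  rw [← integral_Ioc_eq_integral_Ioo, ← integral_Ioc_eq_integral_Ioo,
    ← intervalIntegral.integral_of_le (by linarith), ← intervalIntegral.integral_of_le (by linarith),
    ← intervalIntegral.integral_comp_sub_left F x, ← intervalIntegral.integral_comp_add_left F x,
    ← intervalIntegral.integral_add]
  rotate_left
  · refine ContinuousOn.intervalIntegrable_of_Icc hR.le (hc1.comp (by fun_prop) fun t ht => ?_)
    exact ⟨by linarith [ht.2], by linarith [ht.1]⟩
  · refine ContinuousOn.intervalIntegrable_of_Icc hR.le (hc2.comp (by fun_prop) fun t ht => ?_)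
    exact ⟨by linarith [ht.1], by linarith [ht.2]⟩
  rw [intervalIntegral.integral_interval_sub_left
    (Real.continuous_sinc.intervalIntegrable _ _) (Real.continuous_sinc.intervalIntegrable _ _),
    ← intervalIntegral.mul_integral_comp_mul_left, ← mul_assoc,
    ← intervalIntegral.integral_const_mul]
  refine intervalIntegral.integral_congr_ae (ae_of_all _ fun t ht => ?_)
  rw [uIoc_of_le hR.le] at ht
  have ht0 : t ≠ 0 := (hr.trans ht.1).ne'
  rw [hF, deriv_wave, Real.sinc_of_ne_zero (mul_ne_zero hκ.ne' ht0), wave]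
  simp only
  have e1 : κ * (x - t) - θ = (κ * x - θ) - κ * t := by ring
  have e2 : κ * (x + t) - θ = (κ * x - θ) + κ * t := by ring
  have e3 : x - (x - t) = t := by ring
  have e4 : x - (x + t) = -t := by ring
  rw [e1, e2, e3, e4, Real.sin_sub, Real.sin_add]
  field_simp
  ring

/-- The Hilbert transform of the derivative of a wave. -/
theorem HasHilbertTransformAt.eq_wave {κ θ x a : ℝ}
    (h : HasHilbertTransformAt (deriv (wave κ θ)) x a) : a = |κ| * wave κ θ x := by
  have pos : ∀ {κ θ : ℝ}, 0 < κ → HasHilbertTransformAt (deriv (wave κ θ)) x a →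
      a = κ * wave κ θ x := by
    intro κ θ hκ h
    -- The limit is assumed to exist, so one sequence of radii identifies it. The outer radii make
    -- `κ R` the upper limit in `tendsto_integral_sinc`.
    have hr : Tendsto (fun n : ℕ => 1 / ((n : ℝ) + 1)) atTop (𝓝[>] 0) :=
      tendsto_nhdsWithin_iff.mpr
        ⟨tendsto_one_div_add_atTop_nhds_zero_nat, Eventually.of_forall fun n => by
          simp only [mem_Ioi]; positivity⟩
    have hn : Tendsto (fun n : ℕ => 2 * (n : ℝ) + 1) atTop atTop :=
      tendsto_atTop_add_const_right _ _
        (tendsto_natCast_atTop_atTop.const_mul_atTop (by norm_num))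
    have hR : Tendsto (fun n : ℕ => (2 * (n : ℝ) + 1) * (Real.pi / 2) / κ) atTop atTop :=
      (hn.atTop_mul_const (by positivity)).atTop_div_const hκ
    have h1 := Tendsto.comp h (hr.prodMk hR)
    have hprim : Tendsto (fun r : ℝ => ∫ t in (0 : ℝ)..κ * r, Real.sinc t) (𝓝[>] 0) (𝓝 0) := by
      have hc : Continuous fun r : ℝ => ∫ t in (0 : ℝ)..κ * r, Real.sinc t :=
        (intervalIntegral.continuous_primitive
          (fun _ _ => Real.continuous_sinc.intervalIntegrable _ _) 0).comp (by fun_prop)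
      have := hc.tendsto 0
      simp only [mul_zero, intervalIntegral.integral_same] at this
      exact this.mono_left nhdsWithin_le_nhds
    have h2 := ((tendsto_integral_sinc.sub (hprim.comp hr)).const_mul
      (2 * κ * wave κ θ x)).const_mul (1 / Real.pi)
    refine (tendsto_nhds_unique h1 (h2.congr' ?_)).trans ?_
    · have hev : ∀ᶠ n : ℕ in atTop, 1 / ((n : ℝ) + 1) < (2 * (n : ℝ) + 1) * (Real.pi / 2) / κ := by
        filter_upwards [hR.eventually_gt_atTop 1] with n hn
        refine lt_of_le_of_lt ?_ hn
        rw [div_le_one (by positivity)]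
        linarith [Nat.cast_nonneg (α := ℝ) n]
      filter_upwards [hev] with n hn
      simp only [Function.comp_apply]
      rw [integral_deriv_wave_div hκ (by positivity) hn, mul_div_cancel₀ _ hκ.ne']
    · have := Real.pi_ne_zero
      field_simp
      ring
  rcases lt_trichotomy κ 0 with hκ | rfl | hκ
  · have e : wave κ θ = wave (-κ) (-θ) := by
      ext y
      rw [wave, wave, ← Real.cos_neg]
      congr 1
      ring
    rw [e] at h
    rw [e, abs_of_neg hκ]
    exact pos (by linarith) h
  · rw [deriv_wave] at h
    simp only [HasHilbertTransformAt, neg_zero, zero_mul, zero_div, integral_zero, mul_zero] at h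
    rw [abs_zero, zero_mul]
    exact tendsto_nhds_unique h tendsto_const_nhds
  · rw [abs_of_pos hκ]
    exact pos hκ h

/-! ### Fourier modes and Parseval's identity. -/

section Fourier

variable {bc : Boundary} {ℓ : ℝ}

instance : IsFiniteMeasure (domainMeasure bc ℓ) := by
  cases bc <;> simp only [domainMeasure, domain] <;> infer_instance

theorem integrable_mul_wave (w : State bc ℓ) (κ θ : ℝ) :
    Integrable (fun x => w x * wave κ θ x) (domainMeasure bc ℓ) := by
  refine ((Lp.memLp w).integrable one_le_two).mul_bdd (c := 1) ?_ (ae_of_all _ fun x => ?_)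
  · unfold wave
    exact (by fun_prop : Continuous _).aestronglyMeasurable
  · exact Real.abs_cos_le_one _

/-- The pairing with a wave. -/
noncomputable def wavePairing (κ θ : ℝ) : State bc ℓ →ₗ[ℝ] ℝ where
  toFun w := pairing w (wave κ θ)
  map_add' w w' := by
    simp only [pairing]
    rw [← integral_add (integrable_mul_wave _ _ _) (integrable_mul_wave _ _ _)]
    refine integral_congr_ae ?_
    filter_upwards [Lp.coeFn_add w w'] with x hx
    rw [hx, Pi.add_apply, add_mul]
  map_smul' r w := by
    simp only [pairing, RingHom.id_apply, smul_eq_mul]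
    rw [← integral_const_mul]
    refine integral_congr_ae ?_
    filter_upwards [Lp.coeFn_smul r w] with x hx
    rw [hx, Pi.smul_apply, smul_eq_mul, mul_assoc]

/-- The frequency of the `k`-th Fourier mode. -/
noncomputable def freq (ℓ : ℝ) (k : ℤ) : ℝ := Real.pi * k / ℓ

theorem isTest_wave (hℓ : 0 < ℓ) (k : ℤ) {θ : ℝ} (hθ : bc = .dirichlet → θ = Real.pi / 2) :
    IsTest bc ℓ (wave (freq ℓ k) θ) where
  smooth := by unfold wave; fun_prop
  periodic x := by
    have : freq ℓ k * (x + 2 * ℓ) - θ = (freq ℓ k * x - θ) + k * (2 * Real.pi) := by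
      rw [freq]; field_simp; ring
    rw [wave, wave, this, Real.cos_add_int_mul_two_pi]
  odd h x := by
    rw [wave, wave, hθ h, Real.cos_sub_pi_div_two, Real.cos_sub_pi_div_two, mul_neg, Real.sin_neg]

theorem pairing_const_mul (u : State bc ℓ) (a : ℝ) (φ : ℝ → ℝ) :
    pairing u (fun x => a * φ x) = a * pairing u φ := by
  simp only [pairing]
  rw [← integral_const_mul]
  congr 1
  ext x
  ring

theorem IsLaplacian.wavePairing_eq {u w : State bc ℓ} (h : IsLaplacian u w) {κ θ : ℝ}
    (ht : IsTest bc ℓ (wave κ θ)) : wavePairing κ θ w = -κ ^ 2 * wavePairing κ θ u := by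
  have := h _ ht
  rwa [deriv_deriv_wave, pairing_const_mul] at this

theorem IsHilbertDeriv.wavePairing_eq {u w : State bc ℓ} (h : IsHilbertDeriv u w) {κ θ : ℝ}
    (ht : IsTest bc ℓ (wave κ θ)) : wavePairing κ θ w = |κ| * wavePairing κ θ u := by
  obtain ⟨χ, hχ, e⟩ := h _ ht
  have : χ = fun x => |κ| * wave κ θ x := funext fun x => (hχ x).eq_wave
  rwa [this, pairing_const_mul] at e

/-- Differentiation shifts the phase by a quarter turn, so a single real wave is not an eigenvector.
This is why the periodic coefficient combines two phases into a complex number. -/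
theorem IsDeriv.wavePairing_eq {u w : State bc ℓ} (h : IsDeriv u w) {κ θ : ℝ}
    (ht : IsTest bc ℓ (wave κ θ)) :
    wavePairing κ θ w = κ * wavePairing κ (θ + Real.pi / 2) u := by
  have := h _ ht
  have e : deriv (wave κ θ) = fun y => -κ * wave κ (θ + Real.pi / 2) y := by
    rw [deriv_wave]
    ext y
    rw [wave, ← sub_sub, Real.cos_sub_pi_div_two]
  rw [e, pairing_const_mul] at this
  rw [wavePairing, LinearMap.coe_mk, AddHom.coe_mk, this, wavePairing, LinearMap.coe_mk,
    AddHom.coe_mk]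
  ring

theorem wavePairing_pi (κ : ℝ) (u : State bc ℓ) :
    wavePairing κ (Real.pi / 2 + Real.pi / 2) u = -wavePairing κ 0 u := by
  have e : wave κ (Real.pi / 2 + Real.pi / 2) = fun y => -1 * wave κ 0 y := by
    ext y
    rw [wave, wave, add_halves, Real.cos_sub_pi, sub_zero, neg_one_mul]
  simp only [wavePairing, LinearMap.coe_mk, AddHom.coe_mk]
  rw [e, pairing_const_mul, neg_one_mul]

theorem State.norm_sq_eq (w : State bc ℓ) : ‖w‖ ^ 2 = ∫ x, w x ^ 2 ∂(domainMeasure bc ℓ) := by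
  rw [← real_inner_self_eq_norm_sq, L2.inner_def]
  simp [sq]

/-- The `k`-th Fourier coefficient, up to normalization. -/
noncomputable def modeCoeff (k : ℤ) : State bc ℓ →ₗ[ℝ] ℂ :=
  match bc with
  | .dirichlet => (Complex.ofRealCLM : ℝ →ₗ[ℝ] ℂ) ∘ₗ wavePairing (freq ℓ k) (Real.pi / 2)
  | .periodic => (Complex.ofRealCLM : ℝ →ₗ[ℝ] ℂ) ∘ₗ wavePairing (freq ℓ k) 0 -
      (LinearMap.mulLeft ℝ Complex.I) ∘ₗ (Complex.ofRealCLM : ℝ →ₗ[ℝ] ℂ) ∘ₗ wavePairing (freq ℓ k) (Real.pi / 2)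

theorem modeCoeff_dirichlet (k : ℤ) (w : State .dirichlet ℓ) :
    modeCoeff k w = (wavePairing (freq ℓ k) (Real.pi / 2) w : ℂ) := rfl

theorem modeCoeff_periodic (k : ℤ) (w : State .periodic ℓ) :
    modeCoeff k w = (wavePairing (freq ℓ k) 0 w : ℂ) -
      Complex.I * (wavePairing (freq ℓ k) (Real.pi / 2) w : ℂ) := rfl

theorem IsLaplacian.modeCoeff_eq (hℓ : 0 < ℓ) {u w : State bc ℓ} (h : IsLaplacian u w) (k : ℤ) :
    modeCoeff k w = -(freq ℓ k : ℂ) ^ 2 * modeCoeff k u := by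
  cases bc
  · rw [modeCoeff_dirichlet, modeCoeff_dirichlet, h.wavePairing_eq (isTest_wave hℓ k fun _ => rfl)]
    push_cast; ring
  · rw [modeCoeff_periodic, modeCoeff_periodic,
      h.wavePairing_eq (isTest_wave hℓ k fun h => nomatch h),
      h.wavePairing_eq (isTest_wave hℓ k fun h => nomatch h)]
    push_cast; ring

theorem IsHilbertDeriv.modeCoeff_eq (hℓ : 0 < ℓ) {u w : State bc ℓ} (h : IsHilbertDeriv u w)
    (k : ℤ) : modeCoeff k w = (|freq ℓ k| : ℝ) * modeCoeff k u := by
  cases bc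
  · rw [modeCoeff_dirichlet, modeCoeff_dirichlet, h.wavePairing_eq (isTest_wave hℓ k fun _ => rfl)]
    push_cast; ring
  · rw [modeCoeff_periodic, modeCoeff_periodic,
      h.wavePairing_eq (isTest_wave hℓ k fun h => nomatch h),
      h.wavePairing_eq (isTest_wave hℓ k fun h => nomatch h)]
    push_cast; ring

theorem IsDeriv.modeCoeff_eq (hℓ : 0 < ℓ) {u w : State .periodic ℓ} (h : IsDeriv u w)
    (k : ℤ) : modeCoeff k w = Complex.I * freq ℓ k * modeCoeff k u := by
  rw [modeCoeff_periodic, modeCoeff_periodic,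
    h.wavePairing_eq (isTest_wave hℓ k fun h => nomatch h),
    h.wavePairing_eq (isTest_wave hℓ k fun h => nomatch h), wavePairing_pi, zero_add]
  push_cast
  linear_combination ((freq ℓ k : ℂ) * (wavePairing (freq ℓ k) (Real.pi / 2) u : ℂ)) *
    Complex.I_sq

/-- The period is a variable because it appears both as `2 * ℓ - 0` and as `ℓ - -ℓ`. -/
theorem fourier_neg_eq {p : ℝ} (hp : p = 2 * ℓ) (k : ℤ) (x : ℝ) :
    fourier (-k) (x : AddCircle p) =
      (wave (freq ℓ k) 0 x : ℂ) - Complex.I * (wave (freq ℓ k) (Real.pi / 2) x : ℂ) := by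
  rw [fourier_coe_apply, wave, wave, sub_zero, Real.cos_sub_pi_div_two]
  have : 2 * (Real.pi : ℂ) * Complex.I * ((-k : ℤ) : ℂ) * x / p =
      -(freq ℓ k * x : ℝ) * Complex.I := by
    rw [hp, freq]
    push_cast
    rcases eq_or_ne ℓ 0 with rfl | h
    · simp
    · have : (ℓ : ℂ) ≠ 0 := by exact_mod_cast h
      field_simp
  rw [this, Complex.exp_mul_I, Complex.cos_neg, Complex.sin_neg, Complex.ofReal_cos,
    Complex.ofReal_sin]
  ring

theorem hasSum_of_forall_eq {f g : ℤ → ℝ} {a : ℝ} (h : HasSum f a) (hfg : ∀ k, f k = g k) :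
    HasSum g a :=
  funext hfg ▸ h

/-- The mode coefficient is `2ℓ` times the normalized Fourier coefficient on `(0, 2ℓ)`. -/
theorem hasSum_norm_sq_modeCoeff_periodic (hℓ : 0 < ℓ) (w : State .periodic ℓ) :
    HasSum (fun k : ℤ => ‖modeCoeff k w‖ ^ 2) (2 * ℓ * ‖w‖ ^ 2) := by
  have hab : (0 : ℝ) < 2 * ℓ := by positivity
  have hm : MemLp (fun x => (w x : ℂ)) 2 (volume.restrict (Ioc 0 (2 * ℓ))) := by
    rw [← restrict_Ioo_eq_restrict_Ioc]
    exact (Lp.memLp w).ofReal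
  have h := (hasSum_sq_fourierCoeffOn hab hm).mul_left ((2 * ℓ) ^ 2)
  refine Eq.subst (motive := fun a => HasSum _ a) ?_ (hasSum_of_forall_eq h fun k => ?_)
  rotate_left
  · symm
    rw [fourierCoeffOn_eq_integral, intervalIntegral.integral_of_le hab.le,
      integral_Ioc_eq_integral_Ioo]
    have e : ∫ x in Ioo 0 (2 * ℓ), fourier (-k) (x : AddCircle (2 * ℓ - 0)) • (w x : ℂ) =
        modeCoeff k w := by
      rw [modeCoeff_periodic]
      simp only [wavePairing, LinearMap.coe_mk, AddHom.coe_mk, pairing]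
      rw [← integral_complex_ofReal, ← integral_complex_ofReal, ← integral_const_mul, ← integral_sub]
      · refine integral_congr_ae (ae_of_all _ fun x => ?_)
        simp only [fourier_neg_eq (sub_zero (2 * ℓ)), smul_eq_mul]
        push_cast
        ring
      · exact (integrable_mul_wave w _ _).ofReal
      · exact (integrable_mul_wave w _ _).ofReal.const_mul _
    rw [e, norm_smul, Real.norm_of_nonneg (by simp [hℓ.le]), sub_zero]
    field_simp
  · symm
    rw [State.norm_sq_eq, intervalIntegral.integral_of_le hab.le, integral_Ioc_eq_integral_Ioo]
    simp only [Complex.norm_real, Real.norm_eq_abs, sq_abs, smul_eq_mul, sub_zero]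
    change 2 * ℓ * ∫ x in Ioo 0 (2 * ℓ), w x ^ 2 = _
    field_simp

/-- Parseval on `(-ℓ, ℓ)` for the odd extension `G x - G (-x)`. The two summands have disjoint
supports, so its squared norm is `2‖w‖²`, and its unnormalized coefficient is `-2i` times the sine
coefficient. -/
theorem hasSum_norm_sq_modeCoeff_dirichlet (hℓ : 0 < ℓ) (w : State .dirichlet ℓ) :
    HasSum (fun k : ℤ => ‖modeCoeff k w‖ ^ 2) (ℓ * ‖w‖ ^ 2) := by
  have hab : -ℓ < ℓ := by linarith
  set G : ℝ → ℂ := (Ioo 0 ℓ).indicator fun x => (w x : ℂ) with hG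
  have hGm : MemLp G 2 volume :=
    (memLp_indicator_iff_restrict measurableSet_Ioo).mpr (Lp.memLp w).ofReal
  have hGm' : MemLp (fun x => G (-x)) 2 volume :=
    hGm.comp_measurePreserving (Measure.measurePreserving_neg volume)
  have hm : MemLp (fun x => G x - G (-x)) 2 (volume.restrict (Ioc (-ℓ) ℓ)) :=
    (hGm.sub hGm').restrict _
  have hset : Ioc (-ℓ) ℓ ∩ Ioo 0 ℓ = Ioo 0 ℓ :=
    inter_eq_right.mpr fun x hx => ⟨by linarith [hx.1], hx.2.le⟩
  have h := (hasSum_sq_fourierCoeffOn hab hm).mul_left (ℓ ^ 2)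
  refine Eq.subst (motive := fun a => HasSum _ a) ?_ (hasSum_of_forall_eq h fun k => ?_)
  rotate_left
  · symm
    rw [fourierCoeffOn_eq_integral]
    have hb : ∀ x : ℝ, ‖fourier (-k) (x : AddCircle (ℓ - -ℓ))‖ ≤ 1 := fun x => by
      rw [fourier_apply, Circle.norm_coe]
    have hfc : Continuous fun x : ℝ => fourier (-k) (x : AddCircle (ℓ - -ℓ)) := by
      exact (map_continuous _).comp (AddCircle.continuous_mk' _)
    have i1 : ∀ {f : ℝ → ℂ}, MemLp f 2 volume → IntervalIntegrable
        (fun x : ℝ => fourier (-k) (x : AddCircle (ℓ - -ℓ)) * f x) volume (-ℓ) ℓ := by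
      intro f hf
      rw [intervalIntegrable_iff_integrableOn_Ioc_of_le hab.le]
      exact ((hf.restrict _).integrable one_le_two).bdd_mul hfc.aestronglyMeasurable
        (ae_of_all _ hb)
    have e : ∫ x in (-ℓ)..ℓ, fourier (-k) (x : AddCircle (ℓ - -ℓ)) • (G x - G (-x)) =
        -2 * Complex.I * modeCoeff k w := by
      simp only [smul_eq_mul, mul_sub]
      rw [intervalIntegral.integral_sub (i1 hGm) (i1 hGm')]
      have e1 := intervalIntegral.integral_comp_neg (a := -ℓ) (b := ℓ)
        fun x => fourier (-k) ((-x : ℝ) : AddCircle (ℓ - -ℓ)) * G x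
      simp only [neg_neg] at e1
      rw [e1, ← intervalIntegral.integral_sub (i1 hGm)]
      swap
      · rw [intervalIntegrable_iff_integrableOn_Ioc_of_le hab.le]
        exact ((hGm.restrict _).integrable one_le_two).bdd_mul
          (hfc.comp continuous_neg).aestronglyMeasurable (ae_of_all _ fun x => hb (-x))
      rw [modeCoeff_dirichlet]
      simp only [wavePairing, LinearMap.coe_mk, AddHom.coe_mk, pairing]
      rw [← integral_complex_ofReal, ← integral_const_mul, intervalIntegral.integral_of_le hab.le]
      have e2 : (fun x : ℝ => fourier (-k) (x : AddCircle (ℓ - -ℓ)) * G x -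
          fourier (-k) ((-x : ℝ) : AddCircle (ℓ - -ℓ)) * G x) = (Ioo 0 ℓ).indicator fun x =>
          -2 * Complex.I * ((w x * wave (freq ℓ k) (Real.pi / 2) x : ℝ) : ℂ) := by
        ext x
        by_cases hx : x ∈ Ioo 0 ℓ
        · have hp : ℓ - -ℓ = 2 * ℓ := by ring
          have hw0 : wave (freq ℓ k) 0 (-x) = wave (freq ℓ k) 0 x := by
            rw [wave, wave, sub_zero, sub_zero, mul_neg, Real.cos_neg]
          have hw1 := (isTest_wave (bc := .dirichlet) hℓ k fun _ => rfl).odd rfl x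
          rw [hG, indicator_of_mem hx, indicator_of_mem hx, fourier_neg_eq hp, fourier_neg_eq hp,
            hw0, hw1]
          push_cast
          ring
        · rw [hG, indicator_of_notMem hx, indicator_of_notMem hx]; ring
      rw [e2, setIntegral_indicator measurableSet_Ioo, hset]
      rfl
    rw [e, norm_smul, norm_mul, Real.norm_of_nonneg (by rw [sub_neg_eq_add]; positivity)]
    simp only [norm_mul, norm_neg, Complex.norm_ofNat, Complex.norm_I]
    field_simp
    ring
  · symm
    have e : ∀ x, ‖G x - G (-x)‖ ^ 2 = ‖G x‖ ^ 2 + ‖G (-x)‖ ^ 2 := by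
      intro x
      by_cases hx : x ∈ Ioo 0 ℓ
      · have : -x ∉ Ioo 0 ℓ := fun h => by linarith [hx.1, h.1]
        rw [hG, indicator_of_notMem this]; simp
      · rw [hG, indicator_of_notMem hx]; simp
    have hi : ∀ {f : ℝ → ℂ}, MemLp f 2 volume →
        IntervalIntegrable (fun x => ‖f x‖ ^ 2) volume (-ℓ) ℓ := by
      intro f hf
      exact (hf.integrable_norm_pow two_ne_zero).intervalIntegrable
    simp only [e]
    have e1 := intervalIntegral.integral_comp_neg (a := -ℓ) (b := ℓ) fun x => ‖G x‖ ^ 2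
    simp only [neg_neg] at e1
    rw [intervalIntegral.integral_add (hi hGm) (hi hGm'), e1,
      intervalIntegral.integral_of_le hab.le]
    have e2 : (fun x => ‖G x‖ ^ 2) = (Ioo 0 ℓ).indicator fun x => w x ^ 2 := by
      ext x
      by_cases hx : x ∈ Ioo 0 ℓ
      · rw [hG, indicator_of_mem hx, indicator_of_mem hx, Complex.norm_real, Real.norm_eq_abs,
          sq_abs]
      · rw [hG, indicator_of_notMem hx, indicator_of_notMem hx]; simp
    rw [e2, setIntegral_indicator measurableSet_Ioo, hset, State.norm_sq_eq]
    change ℓ * ∫ x in Ioo 0 ℓ, w x ^ 2 = _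
    rw [smul_eq_mul]
    field_simp
    ring

/-- Parseval's identity for both boundary settings. -/
theorem exists_hasSum_norm_sq_modeCoeff (bc : Boundary) (hℓ : 0 < ℓ) :
    ∃ A : ℝ, 0 < A ∧ ∀ w : State bc ℓ, HasSum (fun k : ℤ => ‖modeCoeff k w‖ ^ 2) (A * ‖w‖ ^ 2) := by
  cases bc
  · exact ⟨ℓ, hℓ, hasSum_norm_sq_modeCoeff_dirichlet hℓ⟩
  · exact ⟨2 * ℓ, by positivity, hasSum_norm_sq_modeCoeff_periodic hℓ⟩

end Fourier

/-! ### Truncation errors and summation over modes. -/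

section Taylor

variable {E : Type*} [NormedAddCommGroup E] [NormedSpace ℝ E]

/-- Mean value inequality on `[0, x]`; the factor `1/(n + 1)` from integration is given up, since
constants are irrelevant here. -/
theorem norm_le_mul_pow_succ {G G' : ℝ → E} {h K : ℝ} {n : ℕ} (hK : 0 ≤ K)
    (hG : ∀ x ∈ Icc 0 h, HasDerivWithinAt G (G' x) (Icc 0 h) x)
    (hb : ∀ x ∈ Icc 0 h, ‖G' x‖ ≤ K * x ^ n) (h0 : G 0 = 0) :
    ∀ x ∈ Icc 0 h, ‖G x‖ ≤ K * x ^ (n + 1) := by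
  intro x hx
  have hsub : Icc 0 x ⊆ Icc 0 h := Icc_subset_Icc_right hx.2
  have := (convex_Icc 0 x).norm_image_sub_le_of_norm_hasDerivWithin_le (f := G) (f' := G')
    (C := K * x ^ n) (fun y hy => (hG y (hsub hy)).mono hsub)
    (fun y hy => (hb y (hsub hy)).trans (by have := hy.1; have := hy.2; gcongr))
    (left_mem_Icc.mpr hx.1) (right_mem_Icc.mpr hx.1)
  rw [h0, sub_zero, sub_zero, Real.norm_of_nonneg hx.1] at this
  rw [pow_succ, ← mul_assoc]
  exact this

theorem hasDerivWithinAt_comp_add {u u' : ℝ → E} {S : Set ℝ}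
    (hu : ∀ x ∈ S, HasDerivWithinAt u (u' x) S x) {t h : ℝ} (ht : ∀ x ∈ Icc 0 h, t + x ∈ S)
    {x : ℝ} (hx : x ∈ Icc 0 h) :
    HasDerivWithinAt (fun x => u (t + x)) (u' (t + x)) (Icc 0 h) x := by
  have := (hu _ (ht x hx)).scomp x ((hasDerivWithinAt_id x (Icc 0 h)).const_add t) ht
  simpa only [one_smul] using! this

theorem hasDerivWithinAt_comp_sub {u u' : ℝ → E} {S : Set ℝ}
    (hu : ∀ x ∈ S, HasDerivWithinAt u (u' x) S x) {t h : ℝ} (ht : ∀ x ∈ Icc 0 h, t - x ∈ S)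
    {x : ℝ} (hx : x ∈ Icc 0 h) :
    HasDerivWithinAt (fun x => u (t - x)) (-u' (t - x)) (Icc 0 h) x := by
  have := (hu _ (ht x hx)).scomp x ((hasDerivWithinAt_id x (Icc 0 h)).const_sub t) ht
  simpa only [neg_smul, one_smul] using! this

theorem exists_lipschitz_of_contDiffOn {u : ℝ → E} {T : ℝ} (hT : 0 < T)
    (hu : ContDiffOn ℝ 1 u (Icc 0 T)) :
    ∃ K : ℝ, 0 ≤ K ∧ ∀ x ∈ Icc 0 T, ∀ y ∈ Icc 0 T, ‖u y - u x‖ ≤ K * |y - x| := by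
  have hS := uniqueDiffOn_Icc hT
  have hc := hu.continuousOn_derivWithin hS le_rfl
  obtain ⟨K, hK⟩ := isCompact_Icc.exists_bound_of_continuousOn hc
  refine ⟨max K 0, le_max_right _ _, fun x hx y hy => ?_⟩
  have hd : DifferentiableOn ℝ u (Icc 0 T) := hu.differentiableOn (by norm_num)
  exact (convex_Icc 0 T).norm_image_sub_le_of_norm_derivWithin_le hd
    (fun z hz => (hK z hz).trans (le_max_left _ _)) hx hy

/-- Truncation errors of the midpoint rule and of the backward Euler rule. -/
theorem exists_truncation_bound {u : ℝ → E} {T : ℝ} (hT : 0 < T)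
    (hu : ContDiffOn ℝ 3 u (Icc 0 T)) :
    ∃ C : ℝ, 0 ≤ C ∧ (∀ t h : ℝ, ∀ d : E, 0 ≤ h → 0 ≤ t - h → t + h ≤ T →
      HasDerivWithinAt u d (Icc 0 T) t → ‖u (t + h) - u (t - h) - (2 * h) • d‖ ≤ C * h ^ 3) ∧
      ∀ h : ℝ, ∀ d : E, 0 ≤ h → h ≤ T → HasDerivWithinAt u d (Icc 0 T) T →
        ‖u T - u (T - h) - h • d‖ ≤ C * h ^ 2 := by
  have hS := uniqueDiffOn_Icc hT
  set u₁ := derivWithin u (Icc 0 T) with hu₁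
  set u₂ := derivWithin u₁ (Icc 0 T) with hu₂
  have h₁ : ContDiffOn ℝ 2 u₁ (Icc 0 T) := hu.derivWithin hS (by norm_num)
  have h₂ : ContDiffOn ℝ 1 u₂ (Icc 0 T) := h₁.derivWithin hS (by norm_num)
  have d₀ : ∀ x ∈ Icc 0 T, HasDerivWithinAt u (u₁ x) (Icc 0 T) x := fun x hx =>
    ((hu.differentiableOn (by norm_num)) x hx).hasDerivWithinAt
  have d₁ : ∀ x ∈ Icc 0 T, HasDerivWithinAt u₁ (u₂ x) (Icc 0 T) x := fun x hx =>
    ((h₁.differentiableOn (by norm_num)) x hx).hasDerivWithinAt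
  obtain ⟨K, hK, hKb⟩ := exists_lipschitz_of_contDiffOn hT h₂
  obtain ⟨K', hK', hKb'⟩ := exists_lipschitz_of_contDiffOn hT (h₁.of_le (by norm_num))
  refine ⟨max (2 * K) K', le_max_of_le_right hK', fun t h d hh ht ht' hd => ?_,
    fun h d hh hhT hd => ?_⟩
  · have htm : t ∈ Icc 0 T := ⟨by linarith, by linarith⟩
    obtain rfl : d = u₁ t := (hS t htm).eq_deriv _ hd (d₀ t htm)
    have hp : ∀ x ∈ Icc 0 h, t + x ∈ Icc 0 T := fun x hx =>
      ⟨by linarith [hx.1], by linarith [hx.2]⟩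
    have hm : ∀ x ∈ Icc 0 h, t - x ∈ Icc 0 T := fun x hx =>
      ⟨by linarith [hx.2], by linarith [hx.1]⟩
    -- The symmetric difference cancels the even-order terms. Starting from the Lipschitz bound
    -- `O(x)` on `u₂ (t + x) - u₂ (t - x)`, two integrations give `O(h³)`.
    have b1 := norm_le_mul_pow_succ (h := h) (K := 2 * K) (n := 1)
      (G := fun x => u₁ (t + x) + u₁ (t - x) - (2 : ℝ) • u₁ t)
      (G' := fun x => u₂ (t + x) + -u₂ (t - x)) (by positivity)
      (fun x hx => ((hasDerivWithinAt_comp_add d₁ hp hx).add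
        (hasDerivWithinAt_comp_sub d₁ hm hx)).sub_const _)
      (fun x hx => by
        rw [← sub_eq_add_neg]
        refine (hKb _ (hm x hx) _ (hp x hx)).trans (le_of_eq ?_)
        rw [show t + x - (t - x) = 2 * x by ring, abs_of_nonneg (by linarith [hx.1])]
        ring)
      (by simp [two_smul])
    have b2 := norm_le_mul_pow_succ (h := h) (K := 2 * K) (n := 2)
      (G := fun x => u (t + x) - u (t - x) - x • ((2 : ℝ) • u₁ t))
      (G' := fun x => u₁ (t + x) - -u₁ (t - x) - (1 : ℝ) • ((2 : ℝ) • u₁ t)) (by positivity)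
      (fun x hx => ((hasDerivWithinAt_comp_add d₀ hp hx).sub
        (hasDerivWithinAt_comp_sub d₀ hm hx)).sub
        ((hasDerivWithinAt_id x _).smul_const _))
      (fun x hx => by simpa using b1 x hx)
      (by simp)
    have := b2 h (right_mem_Icc.mpr hh)
    rw [smul_smul, mul_comm h 2] at this
    exact this.trans (by gcongr; exact le_max_left _ _)
  · have htm : T ∈ Icc 0 T := right_mem_Icc.mpr hT.le
    obtain rfl : d = u₁ T := (hS T htm).eq_deriv _ hd (d₀ T htm)
    have hm : ∀ x ∈ Icc 0 h, T - x ∈ Icc 0 T := fun x hx =>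
      ⟨by linarith [hx.2], by linarith [hx.1]⟩
    have b2 := norm_le_mul_pow_succ (h := h) (K := K') (n := 1)
      (G := fun x => u T - u (T - x) - x • u₁ T)
      (G' := fun x => -(-u₁ (T - x)) - (1 : ℝ) • u₁ T) hK'
      (fun x hx => ((hasDerivWithinAt_comp_sub d₀ hm hx).const_sub _).sub
        ((hasDerivWithinAt_id x _).smul_const _))
      (fun x hx => by
        rw [neg_neg, one_smul]
        refine (hKb' _ htm _ (hm x hx)).trans (le_of_eq ?_)
        rw [show T - x - T = -x by ring, abs_neg, abs_of_nonneg hx.1, pow_one])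
      (by simp)
    exact (b2 h (right_mem_Icc.mpr hh)).trans (by gcongr; exact le_max_right _ _)

/-- Convergence of one component whose modes decouple. -/
theorem exists_component_bound {ι : Type*} (c : ι → E →ₗ[ℝ] ℂ) {A : ℝ} (hA : 0 < A)
    (hc : ∀ w, HasSum (fun k => ‖c k w‖ ^ 2) (A * ‖w‖ ^ 2)) (μ : ι → ℂ) {T C₀ : ℝ} (hT : 0 < T)
    (hC₀ : 0 < C₀) {z : ℝ → E} (hz : ContDiffOn ℝ 3 z (Icc 0 T)) :
    ∃ C : ℝ, 0 < C ∧ ∀ N : ℕ, ∀ τ : ℝ, 1 ≤ N → τ = T / N →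
      (∀ k, ∀ y g : ℕ → ℂ, IsScalarBVM N ((T / N : ℝ) * μ k) y g →
        ‖y N‖ ^ 2 ≤ C₀ * (N * ∑ n ∈ Finset.range (N - 1), ‖g (n + 1)‖ ^ 2 + ‖g N‖ ^ 2)) →
      ∀ Z dz dZ : ℕ → E, (∀ n, n ≤ N → HasDerivWithinAt z (dz n) (Icc 0 T) (n * τ)) →
        Z 0 = z 0 →
        (∀ n, 1 ≤ n → n + 1 ≤ N → (1 / (2 * τ)) • (Z (n + 1) - Z (n - 1)) = dZ n) →
        (1 / τ) • (Z N - Z (N - 1)) = dZ N →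
        (∀ k, ∀ n, 1 ≤ n → n ≤ N → c k (dz n) - c k (dZ n) = μ k * (c k (z (n * τ)) - c k (Z n))) →
        ‖z T - Z N‖ ^ 2 ≤ C * τ ^ 4 := by
  obtain ⟨K, hK, hmid, hfin⟩ := exists_truncation_bound hT hz
  -- The summand `1` keeps the constant positive when `K = 0`.
  refine ⟨C₀ * K ^ 2 * (T ^ 2 + 1) + 1, by positivity, ?_⟩
  intro N τ hN hτ hstab Z dz dZ hdz hZ0 hZmid hZfin hdec
  have hNp : (0 : ℝ) < N := by exact_mod_cast hN
  have hτ0 : 0 < τ := by rw [hτ]; positivity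
  have hNτ : (N : ℝ) * τ = T := by rw [hτ]; field_simp
  -- The residuals. The factor `1/2` matches the `2 * g` in the midpoint step of `IsScalarBVM`; the
  -- backward Euler residual carries none.
  let ρ : ℕ → E := fun n => if n < N then
      (1 / 2 : ℝ) • (z ((n + 1 : ℕ) * τ) - z ((n - 1 : ℕ) * τ) - (2 * τ) • dz n)
    else z (N * τ) - z ((N - 1 : ℕ) * τ) - τ • dz N
  have hρmid : ∀ n, 1 ≤ n → n + 1 ≤ N → ‖ρ n‖ ≤ K * τ ^ 3 := by
    intro n hn hn'
    have hle : ((n + 1 : ℕ) : ℝ) * τ ≤ T := by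
      rw [← hNτ]
      have : ((n + 1 : ℕ) : ℝ) ≤ N := by exact_mod_cast hn'
      gcongr
    have h1 : (1 : ℝ) ≤ n := by exact_mod_cast hn
    push_cast at hle
    have := hmid (n * τ) τ (dz n) hτ0.le (by nlinarith) (by linarith) (hdz n (by omega))
    simp only [ρ, if_pos (show n < N by omega), norm_smul]
    rw [show ((n + 1 : ℕ) : ℝ) * τ = n * τ + τ by push_cast; ring,
      show ((n - 1 : ℕ) : ℝ) * τ = n * τ - τ by rw [Nat.cast_sub hn]; push_cast; ring]
    have h2 : ‖(1 / 2 : ℝ)‖ ≤ 1 := by norm_num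
    nlinarith [norm_nonneg (z (n * τ + τ) - z (n * τ - τ) - (2 * τ) • dz n)]
  have hρfin : ‖ρ N‖ ≤ K * τ ^ 2 := by
    have h1 : (1 : ℝ) ≤ N := by exact_mod_cast hN
    have := hfin τ (dz N) hτ0.le (by nlinarith) (hNτ ▸ hdz N le_rfl)
    simp only [ρ, lt_irrefl, if_false]
    rwa [show ((N - 1 : ℕ) : ℝ) * τ = T - τ by rw [Nat.cast_sub hN, ← hNτ]; push_cast; ring, hNτ]
  have hbvm : ∀ k, IsScalarBVM N ((T / N : ℝ) * μ k)
      (fun n => c k (z (n * τ)) - c k (Z n)) (fun n => c k (ρ n)) := by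
    intro k
    rw [← hτ]
    have hτc : (τ : ℂ) ≠ 0 := by exact_mod_cast hτ0.ne'
    refine ⟨by simp [hZ0], fun n hn => ?_, ?_⟩
    · have h1 := congrArg (c k) (hZmid (n + 1) (by omega) (by omega))
      have h2 := hdec k (n + 1) (by omega) (by omega)
      simp only [ρ, if_pos (show n + 1 < N by omega), Nat.add_sub_cancel, map_smul, map_sub,
        Complex.real_smul] at h1 ⊢
      push_cast at h1 h2 ⊢
      have h3 : c k (Z (n + 1 + 1)) - c k (Z n) = 2 * τ * c k (dZ (n + 1)) := by
        rw [← h1]; field_simp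
      rw [show n + 2 = n + 1 + 1 from rfl]
      rw [show ((n : ℝ) + 2) = n + 1 + 1 by ring]
      linear_combination -h3 + 2 * τ * h2
    · have h1 := congrArg (c k) hZfin
      have h2 := hdec k N hN le_rfl
      simp only [ρ, lt_irrefl, if_false, map_smul, map_sub, Complex.real_smul] at h1 ⊢
      push_cast at h1
      have h3 : c k (Z N) - c k (Z (N - 1)) = τ * c k (dZ N) := by
        rw [← h1]; field_simp
      linear_combination -h3 + τ * h2
  -- `C₀` does not depend on the mode, so the scalar estimates can be summed and turned back into
  -- norms by Parseval.
  have hsum : A * ‖z T - Z N‖ ^ 2 ≤ C₀ * (N * ∑ n ∈ Finset.range (N - 1), A * ‖ρ (n + 1)‖ ^ 2 +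
      A * ‖ρ N‖ ^ 2) := by
    refine hasSum_le (fun k => ?_) (hc (z T - Z N)) (((hasSum_sum fun n _ =>
      hc (ρ (n + 1))).mul_left (N : ℝ) |>.add (hc (ρ N))).mul_left C₀)
    have := hstab k _ _ (hbvm k)
    simp only [hNτ] at this
    rwa [map_sub]
  have hS : ∑ n ∈ Finset.range (N - 1), A * ‖ρ (n + 1)‖ ^ 2 ≤ N * (A * (K * τ ^ 3) ^ 2) := by
    calc ∑ n ∈ Finset.range (N - 1), A * ‖ρ (n + 1)‖ ^ 2
        ≤ ∑ n ∈ Finset.range (N - 1), A * (K * τ ^ 3) ^ 2 := by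
          refine Finset.sum_le_sum fun n hn => ?_
          rw [Finset.mem_range] at hn
          have := hρmid (n + 1) (by omega) (by omega)
          gcongr
      _ = ((N - 1 : ℕ) : ℝ) * (A * (K * τ ^ 3) ^ 2) := by
          rw [Finset.sum_const, Finset.card_range, nsmul_eq_mul]
      _ ≤ _ := by gcongr; omega
  have hfinal : A * ‖z T - Z N‖ ^ 2 ≤ A * ((C₀ * K ^ 2 * (T ^ 2 + 1)) * τ ^ 4) := by
    calc A * ‖z T - Z N‖ ^ 2 ≤ C₀ * (N * (N * (A * (K * τ ^ 3) ^ 2)) + A * (K * τ ^ 2) ^ 2) := by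
          refine hsum.trans ?_
          gcongr
      _ = A * (C₀ * K ^ 2 * ((N * τ) ^ 2 + 1) * τ ^ 4) := by ring
      _ = _ := by rw [hNτ]
  have := le_of_mul_le_mul_left hfinal hA
  have h4 : 0 ≤ τ ^ 4 := by positivity
  linarith

end Taylor

/-! ### Symbols, spurious modes and uniform stability. -/

section Modes

variable {bc : Boundary} {ℓ : ℝ}

/-- The symbol of `𝓛` on the `k`-th mode. -/
noncomputable def Drift.symbol (𝓛 : Drift) (ℓ : ℝ) (k : ℤ) : ℂ :=
  match 𝓛 with
  | .zero => 0
  | .reaction δ => -(δ : ℂ)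
  | .advection δ => δ * (Complex.I * freq ℓ k)

theorem Drift.Maps.modeCoeff_eq (hℓ : 0 < ℓ) {𝓛 : Drift} (h𝓛 : 𝓛.Admissible bc)
    {u w : State bc ℓ} (h : 𝓛.Maps u w) (k : ℤ) :
    modeCoeff k w = 𝓛.symbol ℓ k * modeCoeff k u := by
  cases 𝓛 with
  | zero => rw [show w = 0 from h]; simp [Drift.symbol]
  | reaction δ => rw [show w = -(δ • u) from h]; simp [Drift.symbol]
  | advection δ =>
    obtain rfl : bc = .periodic := h𝓛
    obtain ⟨Du, hD, rfl⟩ := h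
    rw [map_smul, hD.modeCoeff_eq hℓ, Drift.symbol, Complex.real_smul]
    ring

/-- The symbol `λ - ε |κ|` of the original equation. -/
noncomputable def stableSymbol (ε ℓ : ℝ) (𝓛 : Drift) (k : ℤ) : ℂ :=
  𝓛.symbol ℓ k - (ε * |freq ℓ k| : ℝ)

/-- The symbol `λ + ε |κ|` of the spurious modes. -/
noncomputable def unstableSymbol (ε ℓ : ℝ) (𝓛 : Drift) (k : ℤ) : ℂ :=
  𝓛.symbol ℓ k + (ε * |freq ℓ k| : ℝ)

/-- Spectrum doubling in symbols: `ε²κ² - λ² = -(λ - ε|κ|)(λ + ε|κ|)`, and `2λ` is the sum of the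
two factors. -/
theorem IsForce.modeCoeff_eq (hℓ : 0 < ℓ) {𝓛 : Drift} (h𝓛 : 𝓛.Admissible bc) {ε : ℝ}
    {u v f w : State bc ℓ} (h : IsForce ε 𝓛 u v f w) (k : ℤ) :
    modeCoeff k w = -(stableSymbol ε ℓ 𝓛 k * unstableSymbol ε ℓ 𝓛 k) * modeCoeff k u +
      (stableSymbol ε ℓ 𝓛 k + unstableSymbol ε ℓ 𝓛 k) * modeCoeff k v +
      stableSymbol ε ℓ 𝓛 k * modeCoeff k f := by
  obtain ⟨Δu, Lu, LLu, Lv, Lf, HDf, h1, h2, h3, h4, h5, h6, rfl⟩ := h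
  simp only [map_add, map_sub, map_neg, map_smul, Complex.real_smul, h1.modeCoeff_eq hℓ,
    h3.modeCoeff_eq hℓ h𝓛, h2.modeCoeff_eq hℓ h𝓛, h4.modeCoeff_eq hℓ h𝓛, h5.modeCoeff_eq hℓ h𝓛,
    h6.modeCoeff_eq hℓ, stableSymbol, unstableSymbol]
  have hsq : ((|freq ℓ k| : ℝ) : ℂ) ^ 2 = (freq ℓ k : ℂ) ^ 2 := by
    rw [← Complex.ofReal_pow, sq_abs, Complex.ofReal_pow]
  push_cast
  linear_combination (-(ε : ℂ) ^ 2 * modeCoeff k u) * hsq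

theorem IsInitialVelocity.modeCoeff_eq (hℓ : 0 < ℓ) {𝓛 : Drift} (h𝓛 : 𝓛.Admissible bc) {ε : ℝ}
    {u₀ v₀ : State bc ℓ} (h : IsInitialVelocity ε 𝓛 u₀ v₀) (k : ℤ) :
    modeCoeff k v₀ = stableSymbol ε ℓ 𝓛 k * modeCoeff k u₀ := by
  obtain ⟨HDu, Lu, h1, h2, rfl⟩ := h
  simp only [map_add, map_neg, map_smul, Complex.real_smul, h1.modeCoeff_eq hℓ,
    h2.modeCoeff_eq hℓ h𝓛, stableSymbol]
  push_cast
  ring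

theorem continuous_modeCoeff (hℓ : 0 < ℓ) (k : ℤ) :
    Continuous (modeCoeff k : State bc ℓ →ₗ[ℝ] ℂ) := by
  obtain ⟨A, hA, hsum⟩ := exists_hasSum_norm_sq_modeCoeff bc hℓ
  refine AddMonoidHomClass.continuous_of_bound (modeCoeff k : State bc ℓ →ₗ[ℝ] ℂ) (√A) fun w => ?_
  have h1 : ‖modeCoeff k w‖ ^ 2 ≤ A * ‖w‖ ^ 2 :=
    le_hasSum (hsum w) k fun _ _ => by positivity
  rw [← abs_of_nonneg (norm_nonneg (modeCoeff k w))]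
  refine (Real.abs_le_sqrt h1).trans (le_of_eq ?_)
  rw [Real.sqrt_mul hA.le, Real.sqrt_sq (norm_nonneg w)]

theorem hasDerivWithinAt_modeCoeff (hℓ : 0 < ℓ) (k : ℤ) {u : ℝ → State bc ℓ} {u' : State bc ℓ}
    {S : Set ℝ} {t : ℝ} (h : HasDerivWithinAt u u' S t) :
    HasDerivWithinAt (fun t => modeCoeff k (u t)) (modeCoeff k u') S t :=
  let L : State bc ℓ →L[ℝ] ℂ := ⟨modeCoeff k, continuous_modeCoeff hℓ k⟩
  L.hasFDerivAt.comp_hasDerivWithinAt t h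

/-- The exact solution has no spurious modes. -/
theorem IsExactSolution.modeCoeff_eq (hℓ : 0 < ℓ) {𝓛 : Drift} (h𝓛 : 𝓛.Admissible bc) {ε T : ℝ}
    {f : ℝ → State bc ℓ} {u₀ v₀ : State bc ℓ} {u v : ℝ → State bc ℓ}
    (hv₀ : IsInitialVelocity ε 𝓛 u₀ v₀) (h : IsExactSolution ε 𝓛 T f u₀ v₀ u v) (k : ℤ) :
    ∀ t ∈ Icc 0 T, modeCoeff k (v t) = stableSymbol ε ℓ 𝓛 k * modeCoeff k (u t) := by
  intro t ht
  set a := stableSymbol ε ℓ 𝓛 k with ha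
  set b := unstableSymbol ε ℓ 𝓛 k with hb
  -- The forcing cancels in `v - a u`, which satisfies `y' = b y`; the integrating factor makes `q`
  -- constant.
  let q : ℝ → ℂ := fun t => Complex.exp (t * (-b)) * (modeCoeff k (v t) - a * modeCoeff k (u t))
  have hq : ∀ t ∈ Icc 0 T, HasDerivWithinAt q 0 (Icc 0 T) t := by
    intro t ht
    obtain ⟨w, hw, hdv⟩ := h.eq_v t ht
    have d1 := hasDerivWithinAt_modeCoeff hℓ k (h.eq_u t ht)
    have d2 := hasDerivWithinAt_modeCoeff hℓ k hdv
    have d3 : HasDerivWithinAt (fun t : ℝ => Complex.exp (t * (-b)))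
        (Complex.exp (t * (-b)) * (1 * (-b))) (Icc 0 T) t :=
      (((hasDerivAt_id t).ofReal_comp.mul_const (-b)).cexp).hasDerivWithinAt
    have := d3.mul (d2.sub (d1.const_mul a))
    refine this.congr_deriv ?_
    rw [hw.modeCoeff_eq hℓ h𝓛, map_add, ← ha, ← hb]
    simp only [Pi.sub_apply]
    ring
  have hT : (0 : ℝ) ≤ T := ht.1.trans ht.2
  have hc := (convex_Icc 0 T).norm_image_sub_le_of_norm_hasDerivWithin_le (f := q)
    (f' := fun _ => 0) (C := 0) hq (fun _ _ => by simp) (left_mem_Icc.mpr hT) ht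
  have hq0 : q 0 = 0 := by
    simp only [q, h.init_u, h.init_v, hv₀.modeCoeff_eq hℓ h𝓛, ← ha, sub_self, mul_zero]
  rw [hq0, sub_zero, zero_mul, norm_le_zero_iff] at hc
  rcases mul_eq_zero.mp hc with h0 | h0
  · exact absurd h0 (Complex.exp_ne_zero _)
  · exact sub_eq_zero.mp h0

/-- The numerical solution has no spurious modes unless the scheme is singular on one of them. -/
theorem IsMidpointBVM.modeCoeff_eq (hℓ : 0 < ℓ) {𝓛 : Drift} (h𝓛 : 𝓛.Admissible bc) {ε τ : ℝ}
    {N : ℕ} (hτ : 0 < τ) {f : ℝ → State bc ℓ} {u₀ v₀ : State bc ℓ} {U V : ℕ → State bc ℓ}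
    (hv₀ : IsInitialVelocity ε 𝓛 u₀ v₀) (h : IsMidpointBVM ε 𝓛 N τ f u₀ v₀ U V) (k : ℤ)
    (hs : ¬ IsSingular N (τ * unstableSymbol ε ℓ 𝓛 k)) :
    ∀ n ≤ N, modeCoeff k (V n) = stableSymbol ε ℓ 𝓛 k * modeCoeff k (U n) := by
  set a := stableSymbol ε ℓ 𝓛 k with ha
  set b := unstableSymbol ε ℓ 𝓛 k with hb
  have hτc : (τ : ℂ) ≠ 0 := by exact_mod_cast hτ.ne'
  -- Subtracting `a` times the first equation from the second removes the forcing, as in continuous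
  -- time.
  have hbvm : IsScalarBVM N (τ * b) (fun n => modeCoeff k (V n) - a * modeCoeff k (U n)) 0 := by
    refine ⟨?_, fun n hn => ?_, ?_⟩
    · simp only [h.init_u, h.init_v, hv₀.modeCoeff_eq hℓ h𝓛, ← ha, sub_self]
    · have h1 := congrArg (modeCoeff k) (h.mid_u (n + 1) (by omega) (by omega))
      have h2 := (h.mid_v (n + 1) (by omega) (by omega)).modeCoeff_eq hℓ h𝓛 k
      simp only [map_smul, map_sub, map_add, Complex.real_smul, Nat.add_sub_cancel, ← ha,
        ← hb] at h1 h2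
      push_cast at h1 h2
      field_simp at h1 h2
      rw [show n + 2 = n + 1 + 1 from rfl, Pi.zero_apply]
      linear_combination h2 - a * h1
    · have h1 := congrArg (modeCoeff k) h.final_u
      have h2 := h.final_v.modeCoeff_eq hℓ h𝓛 k
      simp only [map_smul, map_sub, map_add, Complex.real_smul, ← ha, ← hb] at h1 h2
      push_cast at h1 h2
      field_simp at h1 h2
      rw [Pi.zero_apply]
      linear_combination h2 - a * h1
  exact fun n hn => sub_eq_zero.mp (hbvm.eq_zero hs n hn)

theorem abs_freq (hℓ : 0 < ℓ) (k : ℤ) : |freq ℓ k| = Real.pi * k.natAbs / ℓ := by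
  rw [freq, abs_div, abs_mul, abs_of_pos Real.pi_pos, abs_of_pos hℓ, Nat.cast_natAbs, Int.cast_abs]

/-- Advection contributes `iδκ`, which changes sign with `k` while `|κ|` does not; hence two slopes
in `|k|`, with the same positive real part. -/
theorem exists_unstableSymbol_eq (hℓ : 0 < ℓ) {ε : ℝ} (hε : 0 < ε) (𝓛 : Drift) :
    ∃ a b b' : ℂ, 0 < b.re ∧ 0 < b'.re ∧ ∀ k : ℤ,
      unstableSymbol ε ℓ 𝓛 k = a + b * k.natAbs ∨ unstableSymbol ε ℓ 𝓛 k = a + b' * k.natAbs := by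
  have hpos : 0 < ε * Real.pi / ℓ := by have := Real.pi_pos; positivity
  have hlc : (ℓ : ℂ) ≠ 0 := by exact_mod_cast hℓ.ne'
  cases 𝓛 with
  | zero =>
    refine ⟨0, (ε * Real.pi / ℓ : ℝ), (ε * Real.pi / ℓ : ℝ), hpos, hpos, fun k => Or.inl ?_⟩
    rw [unstableSymbol, abs_freq hℓ, Drift.symbol]
    push_cast; ring
  | reaction δ =>
    refine ⟨-δ, (ε * Real.pi / ℓ : ℝ), (ε * Real.pi / ℓ : ℝ), hpos, hpos, fun k => Or.inl ?_⟩
    rw [unstableSymbol, abs_freq hℓ, Drift.symbol]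
    push_cast; ring
  | advection δ =>
    refine ⟨0, (ε * Real.pi / ℓ : ℝ) + (δ * Real.pi / ℓ : ℝ) * Complex.I,
      (ε * Real.pi / ℓ : ℝ) + (-(δ * Real.pi / ℓ) : ℝ) * Complex.I,
      by simpa using hpos, by simpa using hpos, fun k => ?_⟩
    rw [unstableSymbol, abs_freq hℓ, Drift.symbol, freq]
    rcases Int.natAbs_eq k with h | h
    · left
      have hk : (k : ℂ) = k.natAbs := by
        conv_lhs => rw [h]
        simp
      push_cast
      rw [hk]; ring
    · right
      have hk : (k : ℂ) = -k.natAbs := by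
        conv_lhs => rw [h]
        simp
      push_cast
      rw [hk]; ring

theorem exists_not_isSingular_unstableSymbol (hℓ : 0 < ℓ) {ε T : ℝ} (hε : 0 < ε) (hT : 0 < T)
    (𝓛 : Drift) : ∃ N₀ : ℕ, 1 ≤ N₀ ∧ ∀ N, N₀ ≤ N → ∀ k : ℤ,
      ¬ IsSingular N ((T / N : ℝ) * unstableSymbol ε ℓ 𝓛 k) := by
  obtain ⟨a, b, b', hb, hb', hk⟩ := exists_unstableSymbol_eq hℓ hε 𝓛
  have h2T : ∀ {b : ℂ}, 0 < b.re → 0 < ((2 * T : ℝ) * b).re := fun hb => by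
    rw [Complex.re_ofReal_mul]; positivity
  obtain ⟨N₁, h1, hN₁⟩ := exists_not_isSingular ((2 * T : ℝ) * a) _ (h2T hb)
  obtain ⟨N₂, -, hN₂⟩ := exists_not_isSingular ((2 * T : ℝ) * a) _ (h2T hb')
  have e : ∀ (b : ℂ) (N j : ℕ), ((T / N : ℝ) : ℂ) * (a + b * j) =
      ((2 * T : ℝ) * a + (2 * T : ℝ) * b * j) / N / 2 := by
    intro b N j; push_cast; ring
  refine ⟨max N₁ N₂, le_max_of_le_left h1, fun N hN k => ?_⟩
  rcases hk k with h | h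
  · rw [h, e]; exact hN₁ N ((le_max_left _ _).trans hN) _
  · rw [h, e]; exact hN₂ N ((le_max_right _ _).trans hN) _

theorem exists_symbol_bound (ℓ : ℝ) (𝓛 : Drift) : ∃ D : ℝ, 0 ≤ D ∧ ∀ k : ℤ,
    (𝓛.symbol ℓ k).re ≤ D ∧ ‖𝓛.symbol ℓ k‖ ≤ D * (1 + |freq ℓ k|) := by
  cases 𝓛 with
  | zero => exact ⟨0, le_rfl, fun k => by simp [Drift.symbol]⟩
  | reaction δ =>
    refine ⟨|δ|, abs_nonneg δ, fun k => ⟨by simpa [Drift.symbol] using neg_le_abs δ, ?_⟩⟩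
    simp only [Drift.symbol, norm_neg, Complex.norm_real, Real.norm_eq_abs]
    nlinarith [abs_nonneg δ, abs_nonneg (freq ℓ k)]
  | advection δ =>
    refine ⟨|δ|, abs_nonneg δ, fun k => ⟨by simp [Drift.symbol], ?_⟩⟩
    simp only [Drift.symbol, norm_mul, Complex.norm_real, Real.norm_eq_abs, Complex.norm_I, one_mul]
    nlinarith [abs_nonneg δ, abs_nonneg (freq ℓ k)]

/-- If `ε|κ| ≥ D + 1`, the real part is at most `-1`. Otherwise `|κ| ≤ (D + 1)/ε`, and the whole
symbol is bounded independently of `k`. -/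
theorem exists_stability_stableSymbol (ℓ : ℝ) {ε T : ℝ} (hε : 0 < ε) (hT : 0 < T) (𝓛 : Drift) :
    ∃ C : ℝ, 0 < C ∧ ∃ N₀ : ℕ, 1 ≤ N₀ ∧ ∀ N : ℕ, N₀ ≤ N → ∀ k : ℤ, ∀ y g : ℕ → ℂ,
      IsScalarBVM N ((T / N : ℝ) * stableSymbol ε ℓ 𝓛 k) y g →
      ‖y N‖ ^ 2 ≤ C * (N * ∑ n ∈ Finset.range (N - 1), ‖g (n + 1)‖ ^ 2 + ‖g N‖ ^ 2) := by
  obtain ⟨D, hD, hDk⟩ := exists_symbol_bound ℓ 𝓛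
  obtain ⟨C₁, hC₁, N₀, hN₀, h₁⟩ :=
    exists_stability_bounded T (D * (1 + (D + 1) / ε) + (D + 1)) hT
  obtain ⟨C₂, hC₂, h₂⟩ := exists_stability_re_neg T hT
  refine ⟨max C₁ C₂, lt_max_of_lt_left hC₁, N₀, hN₀, fun N hN k y g h => ?_⟩
  have hQ : 0 ≤ N * ∑ n ∈ Finset.range (N - 1), ‖g (n + 1)‖ ^ 2 + ‖g N‖ ^ 2 := by positivity
  rcases le_total (D + 1) (ε * |freq ℓ k|) with hk | hk
  · refine (h₂ N (hN₀.trans hN) _ ?_ y g h).trans (by gcongr; exact le_max_right _ _)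
    rw [stableSymbol, Complex.sub_re, Complex.ofReal_re]
    linarith [(hDk k).1]
  · refine (h₁ N hN _ ?_ y g h).trans (by gcongr; exact le_max_left _ _)
    have hf : |freq ℓ k| ≤ (D + 1) / ε := by rw [le_div_iff₀ hε]; linarith
    refine (norm_sub_le _ _).trans (add_le_add ((hDk k).2.trans (by gcongr)) ?_)
    rw [Complex.norm_real, Real.norm_of_nonneg (by positivity)]
    exact hk

end Modes

end SpectrumDoubling

/-! ### Convergence. -/

theorem mainTheorem1 (bc : SpectrumDoubling.Boundary) (𝓛 : SpectrumDoubling.Drift)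
    (h𝓛 : 𝓛.Admissible bc) (ℓ ε T : ℝ) (hℓ : 0 < ℓ) (hε : 0 < ε) (hT : 0 < T) :
    ∃ τ₀ : ℝ, 0 < τ₀ ∧
      ∀ (f : ℝ → SpectrumDoubling.State bc ℓ) (u₀ v₀ : SpectrumDoubling.State bc ℓ)
        (u v : ℝ → SpectrumDoubling.State bc ℓ),
        SpectrumDoubling.IsInitialVelocity ε 𝓛 u₀ v₀ →
        SpectrumDoubling.IsExactSolution ε 𝓛 T f u₀ v₀ u v →
        ∃ C : ℝ, 0 < C ∧
          ∀ (N : ℕ) (τ : ℝ), 1 ≤ N → τ = T / N → τ ≤ τ₀ →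
            ∀ U V : ℕ → SpectrumDoubling.State bc ℓ,
              SpectrumDoubling.IsMidpointBVM ε 𝓛 N τ f u₀ v₀ U V →
              ‖u T - U N‖ ^ 2 + ‖v T - V N‖ ^ 2 ≤ C * τ ^ 4 := by
  open SpectrumDoubling in
  obtain ⟨N₁, hN₁, hsing⟩ := exists_not_isSingular_unstableSymbol hℓ hε hT 𝓛
  obtain ⟨C₀, hC₀, N₂, -, hstab⟩ := exists_stability_stableSymbol ℓ hε hT 𝓛
  obtain ⟨A, hA, hsum⟩ := exists_hasSum_norm_sq_modeCoeff bc hℓ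
  have hmax : (0 : ℝ) < max N₁ N₂ := by exact_mod_cast lt_max_of_lt_left hN₁
  -- `τ ≤ τ₀` then says that `N` exceeds the thresholds for unique solvability on the spurious modes
  -- and for stability.
  refine ⟨T / (max N₁ N₂ : ℕ), by push_cast; positivity, fun f u₀ v₀ u v hv₀ hex => ?_⟩
  obtain ⟨C₁, hC₁, h₁⟩ := exists_component_bound modeCoeff hA hsum (stableSymbol ε ℓ 𝓛) hT hC₀
    hex.smooth_u
  obtain ⟨C₂, hC₂, h₂⟩ := exists_component_bound modeCoeff hA hsum (stableSymbol ε ℓ 𝓛) hT hC₀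
    hex.smooth_v
  refine ⟨C₁ + C₂, by positivity, fun N τ hN hτ hτ₀ U V hUV => ?_⟩
  have hNp : (0 : ℝ) < N := by exact_mod_cast hN
  have hτ0 : 0 < τ := by rw [hτ]; positivity
  have hNmax : max N₁ N₂ ≤ N := by
    rw [hτ, div_le_div_iff_of_pos_left hT hNp (by exact_mod_cast hmax)] at hτ₀
    exact_mod_cast hτ₀
  have hst := hstab N ((le_max_right _ _).trans hNmax)
  have hmem : ∀ n ≤ N, (n : ℝ) * τ ∈ Icc 0 T := by
    intro n hn
    have : (n : ℝ) ≤ N := by exact_mod_cast hn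
    refine ⟨by positivity, ?_⟩
    calc (n : ℝ) * τ ≤ N * τ := by gcongr
      _ = T := by rw [hτ]; field_simp
  have hexact : ∀ k : ℤ, ∀ n ≤ N, modeCoeff k (v (n * τ)) =
      stableSymbol ε ℓ 𝓛 k * modeCoeff k (u (n * τ)) :=
    fun k n hn => hex.modeCoeff_eq hℓ h𝓛 hv₀ k _ (hmem n hn)
  have hnum : ∀ k : ℤ, ∀ n ≤ N, modeCoeff k (V n) = stableSymbol ε ℓ 𝓛 k * modeCoeff k (U n) :=
    fun k => hUV.modeCoeff_eq hℓ h𝓛 hτ0 hv₀ k (by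
      rw [hτ]; exact hsing N ((le_max_left _ _).trans hNmax) k)
  -- The forcing cancels in the error, and `v = a u` on each mode closes the first equation in `u`
  -- alone.
  have b₁ := h₁ N τ hN hτ hst U (fun n => v (n * τ) + f (n * τ)) (fun n => V n + f (n * τ))
    (fun n hn => hex.eq_u _ (hmem n hn)) (by rw [hUV.init_u, hex.init_u]) hUV.mid_u hUV.final_u
    (fun k n _ hn => by
      rw [map_add, map_add, hexact k n hn, hnum k n hn]; ring)
  choose w hw hdw using hex.eq_v
  let dv : ℕ → State bc ℓ := fun n => if h : n ≤ N then w (n * τ) (hmem n h) else 0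
  let dV : ℕ → State bc ℓ := fun n =>
    if n < N then (1 / (2 * τ)) • (V (n + 1) - V (n - 1)) else (1 / τ) • (V N - V (N - 1))
  have b₂ := h₂ N τ hN hτ hst V dv dV
    (fun n hn => by simp only [dv, dif_pos hn]; exact hdw _ (hmem n hn))
    (by rw [hUV.init_v, hex.init_v])
    (fun n hn hn' => by simp only [dV, if_pos (show n < N by omega)])
    (by simp only [dV, lt_irrefl, if_false])
    (fun k n hn hn' => by
      have hdV : IsForce ε 𝓛 (U n) (V n) (f (n * τ)) (dV n) := by
        rcases hn'.lt_or_eq with h | rfl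
        · simp only [dV, if_pos h]
          exact hUV.mid_v n hn h
        · simp only [dV, lt_irrefl, if_false]
          exact hUV.final_v
      simp only [dv, dif_pos hn']
      -- On the errors, `-a b e_u + (a + b) e_v` with `e_v = a e_u` collapses to `a e_v`.
      rw [(hw _ (hmem n hn')).modeCoeff_eq hℓ h𝓛, hdV.modeCoeff_eq hℓ h𝓛, hexact k n hn',
        hnum k n hn']
      ring)
  rw [add_mul]
  exact add_le_add b₁ b₂
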